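/- Let $d\ge 1$, let $\Omega\subset\mathbb R^d$ be a bounded open set, and let $T>0$. Let $H_0^1(\Omega)$ carry the inner product $\langle u,w\rangle_{H_0^1}=\int_\Omega\nabla u\cdot\nabla w\,dx$, let $H^{-1}(\Omega)$ be its dual, let $\mathcal A=-\Delta:H_0^1(\Omega)\to H^{-1}(\Omega)$ be the Dirichlet Laplacian, $(\mathcal Au)(w)=\int_\Omega\nabla u\cdot\nabla w\,dx$, and let $\langle f,g\rangle_{H^{-1}}=\int_\Omega\nabla\mathcal A^{-1}f\cdot\nabla\mathcal A^{-1}g\,dx$. We write $L^2(H)=L^2(0,T;H)$, $H^1(H)=H^1(0,T;H)$, and regard $H_0^1(\Omega)\subset L^2(\Omega)\subset H^{-1}(\Omega)$ in the usual way. Let $$U_0=\{u\in L^2(H_0^1(\Omega))\cap H^1(H^{-1}(\Omega)):\ u(0)=0\},$$ $$\langle v,u\rangle_{U_0}=\int_0^T\!\!\int_\Omega\big[\nabla v\cdot\nabla u+\nabla\mathcal A^{-1}v_t\cdot\nabla\mathcal A^{-1}u_t\big]\,dx\,dt+\int_\Omega v(T)u(T)\,dx .$$ For every $u\in U_0$ the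 final value $u(T)$ belongs to $L^2(\Omega)$, and we put $\delta_Tu=u(T)$. Let $\underline I$ map an element $v$ of a space $H$ to the constant function $t\mapsto v$ in $L^2(H)$, let $\underline I^*z=\int_0^Tz(s)\,ds$, and let $I:H_0^1(\Omega)\to L^2(\Omega)$ be the embedding. Consider the bounded operator between Hilbert spaces $$\mathcal G=\begin{pmatrix}\partial_t+\mathcal A&\underline I\mathcal A\\ \delta_T&I\end{pmatrix}:\ U_0\times H_0^1(\Omega)\to L^2(H^{-1}(\Omega))\times L^2(\Omega).$$ There is exactly one strongly continuous semigroup $(e^{-\mathcal At})_{t\ge0}$ on $H^{-1}(\Omega)$ whose infinitesimal generator is $-\mathcal A$ with domain $H_0^1(\Omega)$, and, with ${}^*$ denoting the Hilbert space adjoint, the following hold. (i) For $v\in L^2(H^{-1}(\Omega))$ and $t\in[0,T]$, the integrand below is integrable and $$\big((\partial_t+\mathcal A)^*v\big)(t)=\int_0^te^{-\mathcal A(t-s)}v(s)\,ds .$$ (ii) For $v\in L^2(\Omega)$ and $t\in[0,T]$, $$(\delta_T^*v)(t)=\mathcal A\int_0^te^{-\mathcal A(T+t-2s)}v\,ds=\tfrac12\big[e^{-\mathcal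 A(T-t)}-e^{-\mathcal A(T+t)}\big]v,$$ where the integral belongs to $H_0^1(\Omega)$. (iii) $(\underline I\mathcal A)^*v=\mathcal A^{-1}\int_0^Tv(s)\,ds$ for $v\in L^2(H^{-1}(\Omega))$, and $I^*v=\mathcal A^{-1}v$ for $v\in L^2(\Omega)$. (iv) Consequently $$\mathcal G^*=\begin{pmatrix}\int_0^{\cdot}e^{-\mathcal A(\cdot-s)}\,.(s)\,ds&\tfrac12[e^{-\mathcal A(T-\cdot)}-e^{-\mathcal A(T+\cdot)}]\\ \mathcal A^{-1}\underline I^*&\mathcal A^{-1}\end{pmatrix},$$ $$\mathcal G^*\mathcal G=\begin{pmatrix}I+\tfrac12[e^{-\mathcal A(T-\cdot)}-e^{-\mathcal A(T+\cdot)}]\delta_T&\underline I-e^{-\mathcal A\cdot}+\tfrac12[e^{-\mathcal A(T-\cdot)}-e^{-\mathcal A(T+\cdot)}]\\ \underline I^*+2\mathcal A^{-1}\delta_T&TI+\mathcal A^{-1}\end{pmatrix},$$ where in the second matrix $I$ denotes the identity. Elements of $U_0$ are evaluated at $t\in[0,T]$ through their continuous representative with values in $H^{-1}(\Omega)$. 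-/

import Mathlib

open MeasureTheory Filter Topology Set
open scoped ContDiff InnerProductSpace

noncomputable section
namespace BackwardsHeat

/-- A bounded open subset `Ω` of `ℝ^d`. -/
structure BoundedDomain (d : ℕ) where
  carrier : Set (EuclideanSpace ℝ (Fin d))
  isOpen : IsOpen carrier
  isBounded : Bornology.IsBounded carrier

variable {d : ℕ}

/-- `L²(Ω)`. -/
abbrev L2 (Ω : BoundedDomain d) : Type :=
  Lp ℝ 2 (volume.restrict Ω.carrier)

/-- `L²(Ω; ℝ^d)`. -/
abbrev L2Vec (Ω : BoundedDomain d) : Type :=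
  Lp (EuclideanSpace ℝ (Fin d)) 2 (volume.restrict Ω.carrier)

/-- `φ ∈ C_c^∞(Ω)`. -/
structure IsTestFunction (Ω : BoundedDomain d) (φ : EuclideanSpace ℝ (Fin d) → ℝ) : Prop where
  smooth : ContDiff ℝ ∞ φ
  compact : HasCompactSupport φ
  subset : tsupport φ ⊆ Ω.carrier

theorem gradient_add' {φ ψ : EuclideanSpace ℝ (Fin d) → ℝ} {x}
    (h : DifferentiableAt ℝ φ x) (h' : DifferentiableAt ℝ ψ x) :
    gradient (φ + ψ) x = gradient φ x + gradient ψ x := by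
  simp [gradient, fderiv_add h h']

theorem gradient_smul' {φ : EuclideanSpace ℝ (Fin d) → ℝ} {x} (c : ℝ)
    (h : DifferentiableAt ℝ φ x) :
    gradient (c • φ) x = c • gradient φ x := by
  simp [gradient, fderiv_const_smul h]

/-- The space of all pairs `(φ, ∇φ)` with `φ ∈ C_c^∞(Ω)`, in `L²(Ω) × L²(Ω; ℝ^d)`. -/
def testGraph (Ω : BoundedDomain d) : Submodule ℝ (L2 Ω × L2Vec Ω) where
  carrier := {p | ∃ φ, IsTestFunction Ω φ ∧
    p.1 =ᵐ[volume.restrict Ω.carrier] φ ∧ p.2 =ᵐ[volume.restrict Ω.carrier] gradient φ}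
  zero_mem' := by
    refine ⟨0, ⟨contDiff_const, HasCompactSupport.zero, by simp [tsupport]⟩, Lp.coeFn_zero _ _ _, ?_⟩
    have : gradient (0 : EuclideanSpace ℝ (Fin d) → ℝ) = 0 := by
      ext1 x; simp [gradient]
    rw [this]; exact Lp.coeFn_zero _ _ _
  add_mem' := by
    rintro p q ⟨φ, hφ, h1, h2⟩ ⟨ψ, hψ, k1, k2⟩
    refine ⟨φ + ψ, ⟨hφ.smooth.add hψ.smooth, hφ.compact.add hψ.compact,
      (tsupport_add φ ψ).trans (union_subset hφ.subset hψ.subset)⟩, ?_, ?_⟩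
    · filter_upwards [Lp.coeFn_add p.1 q.1, h1, k1] with x e e1 e2
      rw [Prod.fst_add, e, Pi.add_apply, e1, e2, Pi.add_apply]
    · filter_upwards [Lp.coeFn_add p.2 q.2, h2, k2] with x e e1 e2
      rw [Prod.snd_add, e, Pi.add_apply, e1, e2, gradient_add'
        (hφ.smooth.differentiable (by simp) x) (hψ.smooth.differentiable (by simp) x)]
  smul_mem' := by
    rintro c p ⟨φ, hφ, h1, h2⟩
    refine ⟨c • φ, ⟨hφ.smooth.const_smul c, hφ.compact.smul_left (f := fun _ => c),
      (tsupport_smul_subset_right (fun _ => c) φ).trans hφ.subset⟩, ?_, ?_⟩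
    · filter_upwards [Lp.coeFn_smul c p.1, h1] with x e e1
      simp [Prod.smul_fst, e, e1]
    · filter_upwards [Lp.coeFn_smul c p.2, h2] with x e e1
      rw [Prod.smul_snd, e, Pi.smul_apply, e1, gradient_smul' c
        (hφ.smooth.differentiable (by simp) x)]

/-- The Poincaré inequality for test functions. -/
theorem poincare_test [NeZero d] (Ω : BoundedDomain d) {R : ℝ}
    (hΩ : Ω.carrier ⊆ Metric.closedBall 0 R)
    {φ : EuclideanSpace ℝ (Fin d) → ℝ} (hφ : IsTestFunction Ω φ) :
    ∫ x, φ x ^ 2 ≤ (2 * R) ^ 2 * ∫ x, ‖gradient φ x‖ ^ 2 := by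
  have hc : Continuous φ := hφ.smooth.continuous
  have hd : Differentiable ℝ φ := hφ.smooth.differentiable (by simp)
  have hfc : Continuous (fderiv ℝ φ) := hφ.smooth.continuous_fderiv (by simp)
  have hgc : Continuous (gradient φ) :=
    (InnerProductSpace.toDual ℝ _).symm.continuous.comp hfc
  have hgs : HasCompactSupport (gradient φ) := by
    have := hφ.compact.fderiv (𝕜 := ℝ)
    exact this.comp_left (g := (InnerProductSpace.toDual ℝ (EuclideanSpace ℝ (Fin d))).symm) (map_zero _)
  let e : EuclideanSpace ℝ (Fin d) := EuclideanSpace.single 0 1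
  let ℓ : EuclideanSpace ℝ (Fin d) →L[ℝ] ℝ := EuclideanSpace.proj 0
  have hℓe : ℓ e = 1 := by simp [ℓ, e]
  have hs2 : HasCompactSupport (fun x => φ x ^ 2) :=
    hφ.compact.comp_left (g := fun y : ℝ => y ^ 2) (by simp)
  have hfd : ∀ x, fderiv ℝ (fun x => φ x ^ 2) x e = 2 * φ x * fderiv ℝ φ x e := by
    intro x
    rw [((hd x).hasFDerivAt.pow 2).fderiv]
    simp; try ring
  have hi2 : Integrable (fun x => φ x ^ 2) := (hc.pow 2).integrable_of_hasCompactSupport hs2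
  have hig : Integrable (fun x => ‖gradient φ x‖ ^ 2) :=
    Continuous.integrable_of_hasCompactSupport (by fun_prop)
      (hgs.comp_left (g := fun y : EuclideanSpace ℝ (Fin d) => ‖y‖ ^ 2) (by simp))
  have hi3 : Integrable (fun x => fderiv ℝ (fun x => φ x ^ 2) x e * ℓ x) := by
    simp_rw [hfd]
    apply Continuous.integrable_of_hasCompactSupport (by fun_prop)
    exact ((hφ.compact.mul_left (f := fun _ => (2:ℝ))).mul_right).mul_right
  have key := integral_mul_fderiv_eq_neg_fderiv_mul_of_integrable (μ := volume)
    (f := fun x => φ x ^ 2) (g := ℓ) (v := e) hi3 (by simpa [hℓe] using hi2)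
    (((hc.pow 2).mul ℓ.continuous).integrable_of_hasCompactSupport hs2.mul_right)
    (fun x _ => (hd x).pow 2) (fun x _ => ℓ.differentiableAt)
  simp only [ContinuousLinearMap.fderiv, hℓe, mul_one] at key
  have hpt : ∀ x, -(fderiv ℝ (fun x => φ x ^ 2) x e * ℓ x) ≤
      (1/2) * φ x ^ 2 + 2 * R ^ 2 * ‖gradient φ x‖ ^ 2 := by
    intro x
    rw [hfd]
    by_cases hx : x ∈ tsupport φ
    · have h1 : |ℓ x| ≤ R := by
        have h2 := hΩ (hφ.subset hx)
        rw [mem_closedBall_zero_iff] at h2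
        have : ‖x 0‖ ≤ ‖x‖ := PiLp.norm_apply_le x 0
        simpa [ℓ] using this.trans h2
      have h3 : |fderiv ℝ φ x e| ≤ ‖gradient φ x‖ := by
        have h4 : fderiv ℝ φ x e = ⟪gradient φ x, e⟫_ℝ := by
          simp [gradient]
        rw [h4]
        have := abs_real_inner_le_norm (gradient φ x) e
        simpa [e] using this
      have h5 : |fderiv ℝ φ x e * ℓ x| ≤ ‖gradient φ x‖ * R := by
        rw [abs_mul]; gcongr
      set a := fderiv ℝ φ x e * ℓ x with ha
      have h6 : a ^ 2 ≤ (‖gradient φ x‖ * R) ^ 2 := sq_le_sq' (by linarith [neg_abs_le a]) ((le_abs_self a).trans h5)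
      have : 2 * φ x * fderiv ℝ φ x e * ℓ x = 2 * φ x * a := by rw [ha]; ring
      rw [this]
      nlinarith [sq_nonneg (φ x + 2 * a)]
    · have : φ x = 0 := image_eq_zero_of_notMem_tsupport hx
      rw [this]; simp; positivity
  have hint : ∫ x, -(fderiv ℝ (fun x => φ x ^ 2) x e * ℓ x) ≤
      ∫ x, ((1/2) * φ x ^ 2 + 2 * R ^ 2 * ‖gradient φ x‖ ^ 2) :=
    integral_mono hi3.neg ((hi2.const_mul (1/2)).add (hig.const_mul (2 * R ^ 2))) hpt
  have e1 : ∫ x, -(fderiv ℝ (fun x => φ x ^ 2) x e * ℓ x) = ∫ x, φ x ^ 2 := by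
    rw [key, integral_neg]
  have e2 : ∫ x, ((1/2) * φ x ^ 2 + 2 * R ^ 2 * ‖gradient φ x‖ ^ 2)
      = 1/2 * (∫ x, φ x ^ 2) + 2 * R ^ 2 * ∫ x, ‖gradient φ x‖ ^ 2 := by
    rw [integral_add (hi2.const_mul _) (hig.const_mul _), integral_const_mul, integral_const_mul]
  rw [e1, e2] at hint
  linarith

/-- The closure of `{(φ, ∇φ) : φ ∈ C_c^∞(Ω)}` in `L²(Ω) × L²(Ω; ℝ^d)`, i.e. the set of pairs
`(u, ∇u)` with `u` in the `H¹`-closure of `C_c^∞(Ω)`. -/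
def h10Graph (Ω : BoundedDomain d) : Submodule ℝ (L2 Ω × L2Vec Ω) :=
  (testGraph Ω).topologicalClosure

theorem exists_poincare [NeZero d] (Ω : BoundedDomain d) :
    ∃ C : ℝ, 0 ≤ C ∧ ∀ p ∈ h10Graph Ω, ‖p.1‖ ≤ C * ‖p.2‖ := by
  obtain ⟨R, hR⟩ := Ω.isBounded.subset_closedBall 0
  have hΩ : Ω.carrier ⊆ Metric.closedBall 0 (max R 0) :=
    hR.trans (Metric.closedBall_subset_closedBall (le_max_left _ _))
  refine ⟨2 * max R 0, by positivity, fun p hp => ?_⟩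
  have hcl : IsClosed {p : L2 Ω × L2Vec Ω | ‖p.1‖ ≤ 2 * max R 0 * ‖p.2‖} :=
    isClosed_le (by fun_prop) (by fun_prop)
  refine closure_minimal ?_ hcl hp
  rintro p ⟨φ, hφ, h1, h2⟩
  have hφ0 : ∀ x ∉ Ω.carrier, φ x = 0 := fun x hx =>
    image_eq_zero_of_notMem_tsupport fun h => hx (hφ.subset h)
  have hg0 : ∀ x ∉ Ω.carrier, gradient φ x = 0 := fun x hx => by
    have : fderiv ℝ φ x = 0 := image_eq_zero_of_notMem_tsupport
      fun h => hx (hφ.subset (tsupport_fderiv_subset ℝ h))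
    simp [gradient, this]
  have n1 : ‖p.1‖ ^ 2 = ∫ x, φ x ^ 2 := by
    rw [← real_inner_self_eq_norm_sq, MeasureTheory.L2.inner_def,
      ← setIntegral_eq_integral_of_forall_compl_eq_zero (s := Ω.carrier)
        (f := fun x => φ x ^ 2) (fun x hx => by simp [hφ0 x hx])]
    refine integral_congr_ae ?_
    filter_upwards [h1] with x hx
    rw [hx, real_inner_self_eq_norm_sq, Real.norm_eq_abs, sq_abs]
  have n2 : ‖p.2‖ ^ 2 = ∫ x, ‖gradient φ x‖ ^ 2 := by
    rw [← real_inner_self_eq_norm_sq, MeasureTheory.L2.inner_def,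
      ← setIntegral_eq_integral_of_forall_compl_eq_zero (s := Ω.carrier)
        (f := fun x => ‖gradient φ x‖ ^ 2) (fun x hx => by simp [hg0 x hx])]
    refine integral_congr_ae ?_
    filter_upwards [h2] with x hx
    rw [hx, real_inner_self_eq_norm_sq]
  have := poincare_test Ω hΩ hφ
  rw [← n1, ← n2, ← mul_pow] at this
  exact le_of_sq_le_sq this (by positivity)


/-- The Sobolev space `H¹₀(Ω)`; an element is a function `u` in the `H¹`-closure of `C_c^∞(Ω)`
together with its weak gradient. Its inner product is `∫_Ω ∇u · ∇v`, see `H10.inner_eq`. -/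
def H10 (Ω : BoundedDomain d) : Type := h10Graph Ω

namespace H10
variable {Ω : BoundedDomain d}

/-- The function underlying an element of `H¹₀(Ω)`. -/
def fn (u : H10 Ω) : L2 Ω := u.1.1

/-- The weak gradient. -/
def grad (u : H10 Ω) : L2Vec Ω := u.1.2

/-- The inner product `∫_Ω ∇u · ∇v`; it is definite by the Poincaré inequality. -/
@[reducible] def core [NeZero d] (Ω : BoundedDomain d) :
    InnerProductSpace.Core ℝ (h10Graph Ω) :=
  { inner := fun u v => ⟪u.1.2, v.1.2⟫_ℝ
    conj_inner_symm := fun u v => by simp [real_inner_comm]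
    re_inner_nonneg := fun u => by simp
    add_left := fun u v w => by simp [inner_add_left]
    smul_left := fun u v r => by simp [real_inner_smul_left]
    definite := fun u h => by
      obtain ⟨C, _, hC⟩ := exists_poincare Ω
      have h2 : u.1.2 = 0 := inner_self_eq_zero.1 h
      have h1 : u.1.1 = 0 := by
        have := hC _ u.2
        rw [h2, norm_zero, mul_zero] at this
        exact norm_le_zero_iff.1 this
      exact Subtype.ext (Prod.ext h1 h2) }

instance [NeZero d] : NormedAddCommGroup (H10 Ω) := (core Ω).toNormedAddCommGroup

instance [NeZero d] : InnerProductSpace ℝ (H10 Ω) := InnerProductSpace.ofCore (core Ω).toCore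

def pair [NeZero d] (Ω : BoundedDomain d) : H10 Ω →ₗ[ℝ] L2 Ω × L2Vec Ω := (h10Graph Ω).subtype

theorem inner_eq [NeZero d] (u v : H10 Ω) :
    ⟪u, v⟫_ℝ = ∫ x in Ω.carrier, ⟪grad u x, grad v x⟫_ℝ :=
  MeasureTheory.L2.inner_def _ _

theorem norm_eq [NeZero d] (u : H10 Ω) : ‖u‖ = ‖grad u‖ := by
  have h : ⟪u, u⟫_ℝ = ⟪grad u, grad u⟫_ℝ := rfl
  rw [real_inner_self_eq_norm_sq, real_inner_self_eq_norm_sq] at h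
  exact (sq_eq_sq₀ (norm_nonneg _) (norm_nonneg _)).1 h

/-- The embedding `I : H¹₀(Ω) → L²(Ω)`. -/
def embL2 [NeZero d] (Ω : BoundedDomain d) : H10 Ω →L[ℝ] L2 Ω :=
  LinearMap.mkContinuousOfExistsBound ((LinearMap.fst ℝ _ _).comp (pair Ω)) <| by
    obtain ⟨C, _, hC⟩ := exists_poincare Ω
    exact ⟨C, fun u => (hC _ u.2).trans_eq (by rw [norm_eq]; rfl)⟩

instance [NeZero d] : CompleteSpace (H10 Ω) := by
  obtain ⟨C, hC0, hC⟩ := exists_poincare Ω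
  have hb : ∀ u : H10 Ω, ‖pair Ω u‖ ≤ (max C 1) * ‖u‖ := fun u => by
    rw [norm_eq, Prod.norm_def]
    refine max_le ((hC _ u.2).trans ?_) ?_
    · change C * ‖grad u‖ ≤ _
      gcongr; exact le_max_left _ _
    · exact le_mul_of_one_le_left (norm_nonneg _) (le_max_right _ _)
  let P : H10 Ω →L[ℝ] L2 Ω × L2Vec Ω := (pair Ω).mkContinuous _ hb
  have ha : AntilipschitzWith 1 P := P.antilipschitz_of_bound fun u => by
    rw [norm_eq, NNReal.coe_one, one_mul]
    exact le_max_right _ _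
  have hr : range P = (h10Graph Ω : Set (L2 Ω × L2Vec Ω)) := Subtype.range_coe
  rw [completeSpace_iff_isComplete_range (ha.isUniformInducing P.uniformContinuous), hr]
  exact (testGraph Ω).isClosed_topologicalClosure.isComplete

end H10

section
variable [NeZero d]

/-- `H⁻¹(Ω)`, the dual space of `H¹₀(Ω)`. Its inner product is `∫_Ω ∇A⁻¹f · ∇A⁻¹g`, see
`Hm1.inner_eq`. -/
def Hm1 (Ω : BoundedDomain d) : Type := StrongDual ℝ (H10 Ω)

namespace Hm1
variable {Ω : BoundedDomain d}

instance : NormedAddCommGroup (Hm1 Ω) :=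
  inferInstanceAs (NormedAddCommGroup (StrongDual ℝ (H10 Ω)))

instance : NormedSpace ℝ (Hm1 Ω) := inferInstanceAs (NormedSpace ℝ (StrongDual ℝ (H10 Ω)))

instance : CompleteSpace (Hm1 Ω) := inferInstanceAs (CompleteSpace (StrongDual ℝ (H10 Ω)))

/-- An element of `H⁻¹(Ω)` as a functional on `H¹₀(Ω)`. -/
def toFunctional (Ω : BoundedDomain d) : Hm1 Ω ≃ₗᵢ[ℝ] StrongDual ℝ (H10 Ω) :=
  LinearIsometryEquiv.refl ℝ (StrongDual ℝ (H10 Ω))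

end Hm1

/-- The Dirichlet Laplacian `A = -Δ : H¹₀(Ω) → H⁻¹(Ω)`, `⟨A u, w⟩ = ∫_Ω ∇u · ∇w` (see
`laplacian_apply`), as an isometry. -/
def laplacianIso (Ω : BoundedDomain d) : H10 Ω ≃ₗᵢ[ℝ] Hm1 Ω where
  toLinearEquiv :=
    { (InnerProductSpace.toDual ℝ (H10 Ω)).toLinearEquiv with
      map_smul' := fun c u => (InnerProductSpace.toDual ℝ (H10 Ω)).map_smulₛₗ c u }
  norm_map' := (InnerProductSpace.toDual ℝ (H10 Ω)).norm_map

instance (Ω : BoundedDomain d) : InnerProductSpace ℝ (Hm1 Ω) where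
  inner f g := ⟪(laplacianIso Ω).symm f, (laplacianIso Ω).symm g⟫_ℝ
  norm_sq_eq_re_inner f := by
    rw [real_inner_self_eq_norm_sq, LinearIsometryEquiv.norm_map]; rfl
  conj_inner_symm f g := by simp [real_inner_comm]
  add_left f g h := by simp [inner_add_left]
  smul_left f g r := by simp [real_inner_smul_left]

/-- The Dirichlet Laplacian `A = -Δ : H¹₀(Ω) → H⁻¹(Ω)`, with its inverse `A⁻¹`. -/
def laplacian (Ω : BoundedDomain d) : H10 Ω ≃L[ℝ] Hm1 Ω :=
  (laplacianIso Ω).toContinuousLinearEquiv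

theorem laplacian_apply {Ω : BoundedDomain d} (u w : H10 Ω) :
    Hm1.toFunctional Ω (laplacian Ω u) w = ∫ x in Ω.carrier, ⟪u.grad x, w.grad x⟫_ℝ :=
  H10.inner_eq u w

theorem Hm1.inner_eq {Ω : BoundedDomain d} (f g : Hm1 Ω) :
    ⟪f, g⟫_ℝ = ∫ x in Ω.carrier,
      ⟪((laplacian Ω).symm f).grad x, ((laplacian Ω).symm g).grad x⟫_ℝ :=
  H10.inner_eq _ _

/-- The embedding `L²(Ω) → H⁻¹(Ω)`, `f ↦ (w ↦ ∫_Ω f w)`. -/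
def l2ToHm1 (Ω : BoundedDomain d) : L2 Ω →L[ℝ] Hm1 Ω :=
  ((Hm1.toFunctional Ω).symm.toContinuousLinearEquiv :
      StrongDual ℝ (H10 Ω) →L[ℝ] Hm1 Ω) ∘L
    (ContinuousLinearMap.compL ℝ (H10 Ω) (L2 Ω) ℝ).flip (H10.embL2 Ω) ∘L innerSL ℝ

theorem l2ToHm1_apply {Ω : BoundedDomain d} (f : L2 Ω) (w : H10 Ω) :
    Hm1.toFunctional Ω (l2ToHm1 Ω f) w = ∫ x in Ω.carrier, f x * w.fn x := by
  have h : Hm1.toFunctional Ω (l2ToHm1 Ω f) w = ⟪f, w.fn⟫_ℝ := rfl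
  rw [h, L2.inner_def]
  refine integral_congr_ae (Eventually.of_forall fun x => ?_)
  exact mul_comm _ _

/-- The embedding `H¹₀(Ω) → L²(Ω) → H⁻¹(Ω)`. -/
def h10ToHm1 (Ω : BoundedDomain d) : H10 Ω →L[ℝ] Hm1 Ω := l2ToHm1 Ω ∘L H10.embL2 Ω

/-- The Bochner space `L²(0,T;H)`. -/
abbrev L2Time (T : ℝ) (H : Type) [NormedAddCommGroup H] : Type :=
  Lp H 2 (volume.restrict (Ioc 0 T))

theorem inner_primitive {H : Type} [NormedAddCommGroup H] [InnerProductSpace ℝ H]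
    [CompleteSpace H] {T t : ℝ} (ht : t ≤ T) (c : H) (f : L2Time T H) :
    ⟪c, ∫ s in Ioc 0 t, f s⟫_ℝ =
      ⟪indicatorConstLp 2 (measurableSet_Ioc (a := 0) (b := t))
        (measure_ne_top (volume.restrict (Ioc 0 T)) _) c, f⟫_ℝ := by
  rw [L2.inner_indicatorConstLp_eq_inner_setIntegral, Measure.restrict_restrict measurableSet_Ioc,
    inter_eq_left.2 (Ioc_subset_Ioc_right ht)]

/-- The triples `(u, f, y)` with `u ∈ L²(0,T;H¹₀)`, `f ∈ L²(0,T;H⁻¹)`, `y ∈ L²(Ω)` such that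
`u(t) = ∫₀ᵗ f(s) ds` in `H⁻¹` for a.e. `t ∈ (0,T)`, i.e. `u ∈ H¹(0,T;H⁻¹)`, `∂ₜu = f` and `u(0) = 0`,
and `y = ∫₀ᵀ f(s) ds = u(T)`. -/
def u0Submodule (T : ℝ) (Ω : BoundedDomain d) :
    Submodule ℝ (WithLp 2 (L2Time T (H10 Ω) × WithLp 2 (L2Time T (Hm1 Ω) × L2 Ω))) where
  carrier := {p |
    (∀ᵐ t ∂volume.restrict (Ioc 0 T), h10ToHm1 Ω (p.fst t) = ∫ s in Ioc 0 t, p.snd.fst s) ∧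
    l2ToHm1 Ω p.snd.snd = ∫ s in Ioc 0 T, p.snd.fst s}
  zero_mem' := by
    have h : ∀ t ≤ T, ∫ s in Ioc 0 t, (0 : L2Time T (Hm1 Ω)) s = 0 := fun t ht =>
      ext_inner_left ℝ fun c => by rw [inner_primitive ht, inner_zero_right, inner_zero_right]
    refine ⟨?_, ?_⟩
    · filter_upwards [Lp.coeFn_zero (H10 Ω) 2 (volume.restrict (Ioc 0 T)),
        ae_restrict_mem measurableSet_Ioc] with t h0 ht
      exact ((congrArg (h10ToHm1 Ω) h0).trans (map_zero _)).trans (h t ht.2).symm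
    · exact (map_zero (l2ToHm1 Ω)).trans (h T le_rfl).symm
  add_mem' := by
    rintro p q ⟨hp, hp'⟩ ⟨hq, hq'⟩
    have h : ∀ t ≤ T, ∫ s in Ioc 0 t, (p.snd.fst + q.snd.fst : L2Time T (Hm1 Ω)) s =
        (∫ s in Ioc 0 t, p.snd.fst s) + ∫ s in Ioc 0 t, q.snd.fst s := fun t ht =>
      ext_inner_left ℝ fun c => by
        simp only [inner_add_right, inner_primitive ht]
    refine ⟨?_, ?_⟩
    · filter_upwards [Lp.coeFn_add p.fst q.fst, ae_restrict_mem measurableSet_Ioc, hp, hq]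
        with t h0 ht h1 h2
      refine ((congrArg (h10ToHm1 Ω) h0).trans (map_add _ _ _)).trans ?_
      rw [h1, h2]; exact (h t ht.2).symm
    · refine (map_add (l2ToHm1 Ω) _ _).trans ?_
      exact (congrArg₂ (· + ·) hp' hq').trans (h T le_rfl).symm
  smul_mem' := by
    rintro c p ⟨hp, hp'⟩
    have h : ∀ t ≤ T, ∫ s in Ioc 0 t, (c • p.snd.fst : L2Time T (Hm1 Ω)) s =
        c • ∫ s in Ioc 0 t, p.snd.fst s := fun t ht =>
      ext_inner_left ℝ fun e => by
        simp only [real_inner_smul_right, inner_primitive ht]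
    refine ⟨?_, ?_⟩
    · filter_upwards [Lp.coeFn_smul c p.fst, ae_restrict_mem measurableSet_Ioc, hp] with t h0 ht h1
      refine ((congrArg (h10ToHm1 Ω) h0).trans (map_smul (h10ToHm1 Ω) c (p.fst t))).trans ?_
      rw [h1]; exact (h t ht.2).symm
    · refine (map_smul (l2ToHm1 Ω) _ _).trans ?_
      exact (congrArg (c • ·) hp').trans (h T le_rfl).symm

theorem isClosed_u0Submodule (T : ℝ) (Ω : BoundedDomain d) :
    IsClosed (u0Submodule T Ω : Set (WithLp 2 (L2Time T (H10 Ω) ×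
      WithLp 2 (L2Time T (Hm1 Ω) × L2 Ω)))) := by
  refine IsSeqClosed.isClosed fun p q hp hpq => ?_
  have h1 : Tendsto (fun n => (p n).fst) atTop (𝓝 q.fst) :=
    ((WithLp.fstL 2 ℝ _ _).continuous.tendsto q).comp hpq
  have h2 : Tendsto (fun n => (p n).snd) atTop (𝓝 q.snd) :=
    ((WithLp.sndL 2 ℝ _ _).continuous.tendsto q).comp hpq
  have h3 : Tendsto (fun n => (p n).snd.fst) atTop (𝓝 q.snd.fst) :=
    ((WithLp.fstL 2 ℝ _ _).continuous.tendsto q.snd).comp h2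
  have h4 : Tendsto (fun n => (p n).snd.snd) atTop (𝓝 q.snd.snd) :=
    ((WithLp.sndL 2 ℝ _ _).continuous.tendsto q.snd).comp h2
  have h5 : ∀ t ≤ T, ∀ c : Hm1 Ω, Tendsto (fun n => ⟪c, ∫ s in Ioc 0 t, (p n).snd.fst s⟫_ℝ) atTop
      (𝓝 ⟪c, ∫ s in Ioc 0 t, q.snd.fst s⟫_ℝ) := fun t ht c => by
    simp only [inner_primitive ht]
    exact tendsto_const_nhds.inner h3
  refine ⟨?_, ?_⟩
  · obtain ⟨ns, hns, hlim⟩ := (tendstoInMeasure_of_tendsto_Lp h1).exists_seq_tendsto_ae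
    have hall : ∀ᵐ t ∂volume.restrict (Ioc 0 T), ∀ n,
        h10ToHm1 Ω ((p n).fst t) = ∫ s in Ioc 0 t, (p n).snd.fst s :=
      ae_all_iff.2 fun n => (hp n).1
    filter_upwards [hlim, hall, ae_restrict_mem measurableSet_Ioc] with t ht h ht'
    refine ext_inner_left ℝ fun c => ?_
    refine tendsto_nhds_unique (f := fun n => ⟪c, h10ToHm1 Ω ((p (ns n)).fst t)⟫_ℝ)
      (tendsto_const_nhds.inner (((h10ToHm1 Ω).continuous.tendsto _).comp ht)) ?_
    simp only [h]
    exact (h5 t ht'.2 c).comp hns.tendsto_atTop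
  · refine ext_inner_left ℝ fun c => ?_
    refine tendsto_nhds_unique (f := fun n => ⟪c, l2ToHm1 Ω (p n).snd.snd⟫_ℝ)
      (tendsto_const_nhds.inner (((l2ToHm1 Ω).continuous.tendsto _).comp h4)) ?_
    simp only [fun n => (hp n).2]
    exact h5 T le_rfl c

/-- `U₀ = {u ∈ L²(0,T;H¹₀) ∩ H¹(0,T;H⁻¹) : u(0) = 0}`, where `u` is recorded together with its time
derivative and its final value `u(T) ∈ L²(Ω)`, both of which are determined by `u`. The inner product
is `∫₀ᵀ∫_Ω (∇v · ∇u + ∇A⁻¹vₜ · ∇A⁻¹uₜ) + ∫_Ω v(T) u(T)`, see `U0.inner_eq`. -/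
def U0 (T : ℝ) (Ω : BoundedDomain d) : Type := u0Submodule T Ω

instance (T : ℝ) (Ω : BoundedDomain d) : NormedAddCommGroup (U0 T Ω) :=
  inferInstanceAs (NormedAddCommGroup (u0Submodule T Ω))

instance (T : ℝ) (Ω : BoundedDomain d) : InnerProductSpace ℝ (U0 T Ω) :=
  inferInstanceAs (InnerProductSpace ℝ (u0Submodule T Ω))

instance (T : ℝ) (Ω : BoundedDomain d) : CompleteSpace (U0 T Ω) :=
  (isClosed_u0Submodule T Ω).completeSpace_coe

namespace U0

/-- The state as an element of `L²(0,T;H¹₀)`. -/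
def state (T : ℝ) (Ω : BoundedDomain d) : U0 T Ω →L[ℝ] L2Time T (H10 Ω) :=
  WithLp.fstL 2 ℝ _ _ ∘L (u0Submodule T Ω).subtypeL

/-- The time derivative `∂ₜ : U₀ → L²(0,T;H⁻¹)`. -/
def timeDeriv (T : ℝ) (Ω : BoundedDomain d) : U0 T Ω →L[ℝ] L2Time T (Hm1 Ω) :=
  WithLp.fstL 2 ℝ _ _ ∘L WithLp.sndL 2 ℝ _ _ ∘L (u0Submodule T Ω).subtypeL

/-- The observation operator `δ_T : U₀ → L²(Ω)`, `u ↦ u(T)`. -/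
def final (T : ℝ) (Ω : BoundedDomain d) : U0 T Ω →L[ℝ] L2 Ω :=
  WithLp.sndL 2 ℝ _ _ ∘L WithLp.sndL 2 ℝ _ _ ∘L (u0Submodule T Ω).subtypeL

variable {T : ℝ} {Ω : BoundedDomain d}

/-- For `t ∈ [0,T]`, the value `w(t) ∈ H⁻¹(Ω)` of the continuous representative
`w ∈ C([0,T];H⁻¹(Ω))` of `w ∈ U₀`; see `atTime_zero`, `state_ae_eq` and `final_eq`. -/
def atTime (w : U0 T Ω) (t : ℝ) : Hm1 Ω := ∫ s in Ioc 0 t, timeDeriv T Ω w s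

theorem atTime_zero (w : U0 T Ω) : w.atTime 0 = 0 := by simp [atTime]

theorem state_ae_eq (w : U0 T Ω) :
    ∀ᵐ t ∂volume.restrict (Ioc 0 T), h10ToHm1 Ω (state T Ω w t) = atTime w t := w.2.1

theorem final_eq (w : U0 T Ω) : l2ToHm1 Ω (final T Ω w) = atTime w T := w.2.2

theorem inner_eq (v w : U0 T Ω) :
    ⟪v, w⟫_ℝ =
      (∫ t in Ioc 0 T, ∫ x in Ω.carrier,
        ⟪(state T Ω v t).grad x, (state T Ω w t).grad x⟫_ℝ) +
      (∫ t in Ioc 0 T, ∫ x in Ω.carrier,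
        ⟪((laplacian Ω).symm (timeDeriv T Ω v t)).grad x,
          ((laplacian Ω).symm (timeDeriv T Ω w t)).grad x⟫_ℝ) +
      ∫ x in Ω.carrier, final T Ω v x * final T Ω w x := by
  have h : ⟪v, w⟫_ℝ = ⟪state T Ω v, state T Ω w⟫_ℝ +
      (⟪timeDeriv T Ω v, timeDeriv T Ω w⟫_ℝ + ⟪final T Ω v, final T Ω w⟫_ℝ) := rfl
  rw [h, L2.inner_def, L2.inner_def, L2.inner_def, add_assoc]
  simp only [H10.inner_eq, Hm1.inner_eq]
  congr 2
  refine integral_congr_ae (Eventually.of_forall fun x => ?_)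
  exact mul_comm _ _

end U0

/-- The operator `I̲ : H → L²(0,T;H)`, `v ↦ (t ↦ v)`. -/
def timeConst (T : ℝ) (H : Type) [NormedAddCommGroup H] [NormedSpace ℝ H] :
    H →L[ℝ] L2Time T H :=
  Lp.constL 2 (volume.restrict (Ioc 0 T)) ℝ

/-- The operator `∂ₜ + A : U₀ → L²(0,T;H⁻¹)`. -/
def heatOp (T : ℝ) (Ω : BoundedDomain d) : U0 T Ω →L[ℝ] L2Time T (Hm1 Ω) :=
  U0.timeDeriv T Ω +
    (laplacian Ω : H10 Ω →L[ℝ] Hm1 Ω).compLpL 2 (volume.restrict (Ioc 0 T)) ∘L U0.state T Ω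

/-- The operator `I̲A : H¹₀(Ω) → L²(0,T;H⁻¹)`, `θ ↦ (t ↦ A θ)`. -/
def constLaplacian (T : ℝ) (Ω : BoundedDomain d) : H10 Ω →L[ℝ] L2Time T (Hm1 Ω) :=
  timeConst T (Hm1 Ω) ∘L (laplacian Ω : H10 Ω →L[ℝ] Hm1 Ω)

/-- The operator `𝒢 (u, θ) = ((∂ₜ + A) u + I̲A θ, δ_T u + I θ)` between Hilbert products. -/
def allAtOnce (T : ℝ) (Ω : BoundedDomain d) :
    WithLp 2 (U0 T Ω × H10 Ω) →L[ℝ] WithLp 2 (L2Time T (Hm1 Ω) × L2 Ω) :=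
  ((WithLp.prodContinuousLinearEquiv 2 ℝ (L2Time T (Hm1 Ω)) (L2 Ω)).symm :
      L2Time T (Hm1 Ω) × L2 Ω →L[ℝ] WithLp 2 (L2Time T (Hm1 Ω) × L2 Ω)) ∘L
    (((heatOp T Ω ∘L WithLp.fstL 2 ℝ _ _) + (constLaplacian T Ω ∘L WithLp.sndL 2 ℝ _ _)).prod
      ((U0.final T Ω ∘L WithLp.fstL 2 ℝ _ _) + (H10.embL2 Ω ∘L WithLp.sndL 2 ℝ _ _)))

/-- `(S t)_{t ≥ 0}` is the strongly continuous semigroup `e^{-At}` on `H⁻¹(Ω)`, that is, the one whose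
infinitesimal generator is exactly `-A` with domain `H¹₀(Ω)`. Values at `t < 0` are irrelevant. -/
structure IsHeatSemigroup (Ω : BoundedDomain d) (S : ℝ → Hm1 Ω →L[ℝ] Hm1 Ω) : Prop where
  zero : S 0 = ContinuousLinearMap.id ℝ (Hm1 Ω)
  add : ∀ s t, 0 ≤ s → 0 ≤ t → S (s + t) = S s ∘L S t
  continuousOn : ∀ x, ContinuousOn (fun t => S t x) (Ici 0)
  generator : ∀ x y, Tendsto (fun t : ℝ => t⁻¹ • (S t x - x)) (𝓝[>] 0) (𝓝 y) ↔
    ∃ w : H10 Ω, h10ToHm1 Ω w = x ∧ y = -laplacian Ω w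

end
end BackwardsHeat
end

open BackwardsHeat

/-! The norm of `U0` is the one for which `∂ₜ + A` is an isometry: expanding `‖wₜ + A w‖²` in
`L²(H⁻¹)`, the cross term `2 ∫ ⟪A w, wₜ⟫` equals `‖w(T)‖²` by the energy identity (`norm_heatOp`).
Hence `(∂ₜ + A)*` is a left inverse of `∂ₜ + A`, and adjoints can be found by writing down solutions
of heat equations.

For the source `1_{(a,T]} x` the solution is `A⁻¹(x - e^{-A(t-a)} x)` for `t ≥ a`, which agrees with
Duhamel's integral; such sources are total and both sides are continuous in the source when tested
against a vector, which gives (i). For `δ_T*`, Duhamel's formula at time `T` turns `⟪u(T), A⁻¹x⟫`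
into `⟪(∂ₜ + A)u, e^{-A(T-·)}x⟫`. The right factor is `(∂ₜ + A)w` with `A w = ½[e^{-A(T-t)} -
e^{-A(T+t)}]x`, so the isometry gives `δ_T* A⁻¹x = w`, and density of the range of `A⁻¹` in `L²(Ω)`
gives (ii). The remaining entries follow by direct computation, and `𝒢*𝒢` by composing blocks.

Everything rests on one factorization, without spectral theory. With `E = A⁻¹ : H⁻¹ → L²`, the
Hilbert adjoint `E†` is the embedding `L² → H⁻¹`, and `B = E†E` is `A⁻¹` on `H⁻¹`: bounded,
positive, of dense range. The resolvent-type operators `(B + l)⁻¹` serve twice as regularization.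
Their exponentials converge to the semigroup generated by `-B⁻¹` (`invSemigroup`), whose uniqueness
follows from dissipativity; and `B(B + l)⁻¹ → 1` strongly, which justifies the energy identity and
shows that final values lie in `L²(Ω)` (`tendsto_norm_sq_primitive`). -/

noncomputable section
namespace BackwardsHeat

/-! ### Exponentials of positive operators and the regularized inverses `(B + l)⁻¹`. -/

section Abstract

variable {X : Type*} [NormedAddCommGroup X] [InnerProductSpace ℝ X]

/-- A curve that satisfies `⟪w, w'⟫ ≤ 0` does not increase in norm. -/
theorem norm_le_of_inner_deriv_nonpos {w w' : ℝ → X} {t : ℝ} (ht : 0 ≤ t)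
    (hc : ContinuousOn w (Icc 0 t))
    (hd : ∀ s ∈ Ico 0 t, HasDerivWithinAt w (w' s) (Ici s) s)
    (hle : ∀ s ∈ Ico 0 t, ⟪w s, w' s⟫_ℝ ≤ 0) : ‖w t‖ ≤ ‖w 0‖ := by
  have h := image_le_of_deriv_right_le_deriv_boundary (f := fun s => ‖w s‖ ^ 2)
    (f' := fun s => 2 * ⟪w s, w' s⟫_ℝ) (B := fun _ => ‖w 0‖ ^ 2) (B' := fun _ => 0)
    (hc.norm.pow 2) (fun s hs => (hd s hs).norm_sq) le_rfl continuousOn_const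
    (fun s _ => hasDerivWithinAt_const _ _ _)
    (fun s hs => by linarith [hle s hs]) (right_mem_Icc.2 ht)
  exact le_of_sq_le_sq h (norm_nonneg _)

variable [CompleteSpace X]

theorem hasDerivAt_exp_smul_apply (P : X →L[ℝ] X) (x : X) (t : ℝ) :
    HasDerivAt (fun s : ℝ => NormedSpace.exp (s • P) x) (P (NormedSpace.exp (t • P) x)) t :=
  (ContinuousLinearMap.apply ℝ X x).hasFDerivAt.comp_hasDerivAt t
    (hasDerivAt_exp_smul_const' P t)

theorem norm_exp_neg_apply_le {P : X →L[ℝ] X} (hP : P.IsPositive) {t : ℝ} (ht : 0 ≤ t) (x : X) :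
    ‖NormedSpace.exp (t • (-P)) x‖ ≤ ‖x‖ := by
  have h := norm_le_of_inner_deriv_nonpos (w := fun s : ℝ => NormedSpace.exp (s • (-P)) x) ht
    (fun s _ => (hasDerivAt_exp_smul_apply (-P) x s).continuousAt.continuousWithinAt)
    (fun s _ => (hasDerivAt_exp_smul_apply (-P) x s).hasDerivWithinAt)
    (fun s _ => by
      have := hP.inner_nonneg_right (NormedSpace.exp (s • (-P)) x)
      simpa using this)
  simpa using h

theorem exp_add_smul (P : X →L[ℝ] X) (s t : ℝ) :
    NormedSpace.exp ((s + t) • P) = NormedSpace.exp (s • P) * NormedSpace.exp (t • P) := by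
  let _ := NormedAlgebra.restrictScalars ℚ ℝ (X →L[ℝ] X)
  rw [add_smul, NormedSpace.exp_add_of_commute]
  exact ((Commute.refl P).smul_left s).smul_right t

/-- Interpolate by `s ↦ e^{-tP} e^{s(P-Q)} x`, which runs from `e^{-tP} x` to `e^{-tQ} x`.
Commutation rewrites the operator as `e^{-(t-s)P} e^{-sQ}`, a product of contractions, so the
derivative has norm at most `‖(P - Q) x‖`. -/
theorem norm_exp_sub_exp_apply_le {P Q : X →L[ℝ] X} (hP : P.IsPositive) (hQ : Q.IsPositive)
    (hPQ : Commute P Q) {t : ℝ} (ht : 0 ≤ t) (x : X) :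
    ‖NormedSpace.exp (t • (-P)) x - NormedSpace.exp (t • (-Q)) x‖ ≤ ‖(P - Q) x‖ * t := by
  let _ := NormedAlgebra.restrictScalars ℚ ℝ (X →L[ℝ] X)
  have e : ∀ s : ℝ, NormedSpace.exp (t • (-P)) * NormedSpace.exp (s • (P - Q)) =
      NormedSpace.exp ((t - s) • (-P)) * NormedSpace.exp (s • (-Q)) := fun s => by
    rw [← NormedSpace.exp_add_of_commute, ← NormedSpace.exp_add_of_commute]
    · congr 1; module
    · exact ((hPQ.neg_left).neg_right.smul_left _).smul_right _
    · exact (((Commute.refl P).sub_right hPQ).neg_left.smul_left _).smul_right _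
  have hd : ∀ s : ℝ, HasDerivAt
      (fun s : ℝ => NormedSpace.exp (t • (-P)) (NormedSpace.exp (s • (P - Q)) x))
      (NormedSpace.exp (t • (-P)) (NormedSpace.exp (s • (P - Q)) ((P - Q) x))) s := fun s =>
    (NormedSpace.exp (t • (-P))).hasFDerivAt.comp_hasDerivAt s
      ((ContinuousLinearMap.apply ℝ X x).hasFDerivAt.comp_hasDerivAt s
        (hasDerivAt_exp_smul_const (P - Q) s))
  have h := norm_image_sub_le_of_norm_deriv_le_segment' (a := 0) (b := t) (C := ‖(P - Q) x‖)
    (fun s _ => (hd s).hasDerivWithinAt) (fun s hs => by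
      change ‖(NormedSpace.exp (t • (-P)) * NormedSpace.exp (s • (P - Q))) ((P - Q) x)‖ ≤ _
      rw [e]
      exact (norm_exp_neg_apply_le hP (by linarith [hs.2]) _).trans
        (norm_exp_neg_apply_le hQ hs.1 _)) t (right_mem_Icc.2 ht)
  have h1 : NormedSpace.exp (t • (-P)) (NormedSpace.exp (t • (P - Q)) x) =
      NormedSpace.exp (t • (-Q)) x := by
    change (NormedSpace.exp (t • (-P)) * NormedSpace.exp (t • (P - Q))) x = _
    rw [e]; simp
  rw [h1] at h
  rw [norm_sub_rev]
  simpa using h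

/-- `(B + l)⁻¹`. -/
def shiftInv (B : X →L[ℝ] X) (l : ℝ) : X →L[ℝ] X := Ring.inverse (B + l • 1)

variable {B : X →L[ℝ] X}

/-- Coercivity: positivity of `B` gives `⟪(B + l) x, x⟫ ≥ l ‖x‖²`. -/
theorem isUnit_shift (hB : B.IsPositive) {l : ℝ} (hl : 0 < l) : IsUnit (B + l • 1) := by
  refine ContinuousLinearMap.isUnit_of_forall_le_norm_inner_map _ (c := ⟨l, hl.le⟩) hl fun x => ?_
  refine le_trans ?_ (Real.le_norm_self _)
  have h := hB.inner_nonneg_left x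
  have e : ⟪(B + l • (1 : X →L[ℝ] X)) x, x⟫_ℝ = ⟪B x, x⟫_ℝ + l * ‖x‖ ^ 2 := by
    change ⟪B x + l • x, x⟫_ℝ = _
    rw [inner_add_left, real_inner_smul_left, real_inner_self_eq_norm_sq]
  rw [e]
  change ‖x‖ ^ 2 * l ≤ _
  linarith

theorem apply_shiftInv (hB : B.IsPositive) {l : ℝ} (hl : 0 < l) (x : X) :
    B (shiftInv B l x) + l • shiftInv B l x = x :=
  congrArg (fun P : X →L[ℝ] X => P x) (Ring.mul_inverse_cancel _ (isUnit_shift hB hl))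

theorem commute_shiftInv {C : X →L[ℝ] X} (hB : B.IsPositive) {l : ℝ} (hl : 0 < l)
    (hC : Commute C B) : Commute C (shiftInv B l) := by
  have h : Commute C (B + l • 1) := hC.add_right ((Commute.one_right C).smul_right l)
  obtain ⟨u, hu⟩ := isUnit_shift hB hl
  rw [shiftInv, ← hu, Ring.inverse_unit]
  exact Commute.units_inv_right (hu ▸ h)

theorem shiftInv_comm (hB : B.IsPositive) {l : ℝ} (hl : 0 < l) (x : X) :
    B (shiftInv B l x) = shiftInv B l (B x) :=
  congrArg (fun P : X →L[ℝ] X => P x) (commute_shiftInv hB hl (Commute.refl B)).eq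

theorem shiftInv_inner (hB : B.IsPositive) {l : ℝ} (hl : 0 < l) (x y : X) :
    ⟪shiftInv B l x, y⟫_ℝ = ⟪x, shiftInv B l y⟫_ℝ := by
  have h : ⟪B (shiftInv B l x), shiftInv B l y⟫_ℝ = ⟪shiftInv B l x, B (shiftInv B l y)⟫_ℝ :=
    hB.isSymmetric _ _
  conv_lhs => rw [← apply_shiftInv hB hl y]
  conv_rhs => rw [← apply_shiftInv hB hl x]
  rw [inner_add_left, inner_add_right, h, real_inner_smul_left, real_inner_smul_right]

theorem isPositive_shiftInv (hB : B.IsPositive) {l : ℝ} (hl : 0 < l) :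
    (shiftInv B l).IsPositive := by
  refine ⟨fun x y => shiftInv_inner hB hl x y, fun x => ?_⟩
  change 0 ≤ ⟪shiftInv B l x, x⟫_ℝ
  have h := hB.inner_nonneg_right (shiftInv B l x)
  have e : ⟪shiftInv B l x, x⟫_ℝ =
      ⟪shiftInv B l x, B (shiftInv B l x) + l • shiftInv B l x⟫_ℝ := by
    rw [apply_shiftInv hB hl]
  rw [e, inner_add_right, real_inner_smul_right, real_inner_self_eq_norm_sq]
  positivity

/-- The vector `x` is the sum of `B (B + l)⁻¹ x` and `l (B + l)⁻¹ x`, whose inner product is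
nonnegative. -/
theorem norm_apply_shiftInv_le (hB : B.IsPositive) {l : ℝ} (hl : 0 < l) (x : X) :
    ‖B (shiftInv B l x)‖ ≤ ‖x‖ := by
  have h := hB.inner_nonneg_left (shiftInv B l x)
  refine le_of_sq_le_sq ?_ (norm_nonneg x)
  have e : ‖x‖ ^ 2 = ‖B (shiftInv B l x) + l • shiftInv B l x‖ ^ 2 := by
    rw [apply_shiftInv hB hl]
  rw [e, norm_add_sq_real, real_inner_smul_right]
  have := mul_nonneg hl.le h
  nlinarith [sq_nonneg ‖l • shiftInv B l x‖]

/-- The resolvent identity. -/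
theorem shiftInv_sub_apply (hB : B.IsPositive) {l m : ℝ} (hl : 0 < l) (hm : 0 < m) (x : X) :
    shiftInv B l x - shiftInv B m x = (m - l) • shiftInv B l (shiftInv B m x) := by
  have h1 : shiftInv B m (shiftInv B l x) = shiftInv B l (shiftInv B m x) :=
    congrArg (fun P : X →L[ℝ] X => P x) (commute_shiftInv hB hl
      (commute_shiftInv hB hm (Commute.refl B)).symm).eq
  have h2 := apply_shiftInv hB hl (shiftInv B m x)
  have h3 := apply_shiftInv hB hm (shiftInv B l x)
  rw [h1] at h3
  generalize shiftInv B l (shiftInv B m x) = w at h2 h3 ⊢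
  rw [← h2, ← h3]
  module

/-- In the resolvent identity each of the two inverses, unbounded as the parameters tend to `0`,
absorbs one factor `B` into a contraction. This is why the argument must lie in the range of `B²`.
-/
theorem norm_shiftInv_sub_le (hB : B.IsPositive) {l m : ℝ} (hl : 0 < l) (hm : 0 < m) (x : X) :
    ‖(shiftInv B l - shiftInv B m) (B (B x))‖ ≤ |m - l| * ‖x‖ := by
  change ‖shiftInv B l (B (B x)) - shiftInv B m (B (B x))‖ ≤ _
  rw [shiftInv_sub_apply hB hl hm, norm_smul, Real.norm_eq_abs, ← shiftInv_comm hB hm,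
    ← shiftInv_comm hB hl, ← shiftInv_comm hB hm]
  gcongr
  exact (norm_apply_shiftInv_le hB hl _).trans (norm_apply_shiftInv_le hB hm _)

theorem denseRange_of_adjoint_injective {Y : Type*} [NormedAddCommGroup Y] [InnerProductSpace ℝ Y]
    [CompleteSpace Y] {E : X →L[ℝ] Y} (h : Function.Injective E.adjoint) : DenseRange E := by
  have h1 : E.range.topologicalClosure = ⊤ := by
    rw [Submodule.topologicalClosure_eq_top_iff, ContinuousLinearMap.orthogonal_range]
    exact LinearMap.ker_eq_bot.2 h
  have h2 : Dense (E.range : Set Y) := Submodule.dense_iff_topologicalClosure_eq_top.2 h1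
  exact h2

omit [CompleteSpace X] in
theorem tendsto_of_dense {L : ℕ → X →L[ℝ] X} (hL : ∀ n x, ‖L n x‖ ≤ ‖x‖) {G : X →L[ℝ] X}
    (hG : ∀ x, ‖G x‖ ≤ ‖x‖) {s : Set X} (hs : Dense s)
    (h : ∀ x ∈ s, Tendsto (fun n => L n x) atTop (𝓝 (G x))) (x : X) :
    Tendsto (fun n => L n x) atTop (𝓝 (G x)) := by
  rw [Metric.tendsto_atTop]
  intro ε hε
  obtain ⟨y, hy, hxy⟩ := Metric.dense_iff.1 hs x (ε / 3) (by positivity)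
  obtain ⟨N, hN⟩ := Metric.tendsto_atTop.1 (h y hxy) (ε / 3) (by positivity)
  refine ⟨N, fun n hn => ?_⟩
  have h1 := hN n hn
  have h2 : ‖y - x‖ < ε / 3 := by simpa [dist_eq_norm] using hy
  have h3 := hL n (x - y)
  have h4 := hG (y - x)
  rw [norm_sub_rev] at h3
  rw [dist_eq_norm] at h1 ⊢
  calc ‖L n x - G x‖ = ‖L n (x - y) + (L n y - G y) + G (y - x)‖ := by
        simp only [map_sub]; congr 1; abel
    _ ≤ ‖L n (x - y)‖ + ‖L n y - G y‖ + ‖G (y - x)‖ := norm_add₃_le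
    _ < ε := by linarith

omit [CompleteSpace X] in
theorem cauchySeq_of_dense {L : ℕ → X →L[ℝ] X} (hL : ∀ n x, ‖L n x‖ ≤ ‖x‖) {s : Set X}
    (hs : Dense s) (h : ∀ x ∈ s, CauchySeq (fun n => L n x)) (x : X) :
    CauchySeq (fun n => L n x) := by
  rw [Metric.cauchySeq_iff]
  intro ε hε
  obtain ⟨y, hy, hxy⟩ := Metric.dense_iff.1 hs x (ε / 3) (by positivity)
  obtain ⟨N, hN⟩ := Metric.cauchySeq_iff.1 (h y hxy) (ε / 3) (by positivity)
  refine ⟨N, fun m hm n hn => ?_⟩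
  have h1 := hN m hm n hn
  have h2 : ‖y - x‖ < ε / 3 := by simpa [dist_eq_norm] using hy
  have h3 := hL m (x - y)
  have h4 := hL n (y - x)
  rw [norm_sub_rev] at h3
  rw [dist_eq_norm] at h1 ⊢
  calc ‖L m x - L n x‖ = ‖L m (x - y) + (L m y - L n y) + L n (y - x)‖ := by
        simp only [map_sub]; congr 1; abel
    _ ≤ ‖L m (x - y)‖ + ‖L m y - L n y‖ + ‖L n (y - x)‖ := norm_add₃_le
    _ < ε := by linarith

/-- The regularization parameters `1 / (n + 1)`. -/
def reg (n : ℕ) : ℝ := 1 / ((n : ℝ) + 1)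

theorem reg_pos (n : ℕ) : 0 < reg n := Nat.one_div_pos_of_nat

theorem tendsto_reg : Tendsto reg atTop (𝓝 0) := tendsto_one_div_add_atTop_nhds_zero_nat

/-- On the range of `B` the error is `-l B (B + l)⁻¹ y`, of norm at most `l ‖y‖`; the uniform bound
extends the convergence to the closure. -/
theorem tendsto_apply_shiftInv (hB : B.IsPositive) (hd : DenseRange B) (x : X) :
    Tendsto (fun n => B (shiftInv B (reg n) x)) atTop (𝓝 x) := by
  refine tendsto_of_dense (L := fun n => B ∘L shiftInv B (reg n))
    (G := ContinuousLinearMap.id ℝ X)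
    (fun n x => norm_apply_shiftInv_le hB (reg_pos n) x) (fun x => le_rfl) hd ?_ x
  rintro _ ⟨y, rfl⟩
  rw [tendsto_iff_norm_sub_tendsto_zero]
  refine squeeze_zero (fun _ => norm_nonneg _) (g := fun n => reg n * ‖y‖) (fun n => ?_)
    (by simpa using tendsto_reg.mul_const ‖y‖)
  have h := apply_shiftInv hB (reg_pos n) (B y)
  have e : B (shiftInv B (reg n) (B y)) - B y = -(reg n • B (shiftInv B (reg n) y)) := by
    rw [shiftInv_comm hB (reg_pos n) y]
    rw [← sub_eq_zero, ← sub_eq_zero.2 h]; abel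
  change ‖B (shiftInv B (reg n) (B y)) - B y‖ ≤ _
  rw [e, norm_neg, norm_smul, Real.norm_eq_abs, abs_of_pos (reg_pos n)]
  have := norm_apply_shiftInv_le hB (reg_pos n) y
  have := reg_pos n
  gcongr

end Abstract

/-! ### The contraction semigroup generated by `-B⁻¹`: construction, generator, uniqueness. -/

section Semigroup

variable {X : Type*} [NormedAddCommGroup X] [InnerProductSpace ℝ X] [CompleteSpace X]
  {B : X →L[ℝ] X}

/-- The exponential `exp (-t (B + 1 / (n + 1))⁻¹)`, extended by the identity to `t ≤ 0`. -/
def approxExp (B : X →L[ℝ] X) (n : ℕ) (t : ℝ) : X →L[ℝ] X :=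
  NormedSpace.exp (max t 0 • (-shiftInv B (reg n)))

theorem norm_approxExp_le (hB : B.IsPositive) (n : ℕ) (t : ℝ) (x : X) :
    ‖approxExp B n t x‖ ≤ ‖x‖ :=
  norm_exp_neg_apply_le (isPositive_shiftInv hB (reg_pos n)) (le_max_right _ _) x

theorem continuous_approxExp (B : X →L[ℝ] X) (n : ℕ) (x : X) :
    Continuous fun t => approxExp B n t x := by
  have h : Continuous fun t : ℝ => NormedSpace.exp (t • (-shiftInv B (reg n))) x :=
    continuous_iff_continuousAt.2 fun t => (hasDerivAt_exp_smul_apply _ x t).continuousAt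
  exact h.comp (continuous_id.max continuous_const)

/-- On the dense range of `B²` the generators `-(B + 1/(n+1))⁻¹` form a Cauchy sequence, and
commuting contraction exponentials differ by at most `t` times the difference of their generators.
-/
theorem cauchySeq_approxExp (hB : B.IsPositive) (hd : DenseRange B) (t : ℝ) (x : X) :
    CauchySeq fun n => approxExp B n t x := by
  refine cauchySeq_of_dense (fun n => norm_approxExp_le hB n t) (hd.comp hd B.continuous) ?_ x
  rintro _ ⟨y, rfl⟩
  have hr : CauchySeq fun n => (max t 0 * ‖y‖) * reg n :=
    (tendsto_reg.const_mul _).cauchySeq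
  rw [Metric.cauchySeq_iff] at hr ⊢
  intro ε hε
  obtain ⟨N, hN⟩ := hr ε hε
  refine ⟨N, fun m hm n hn => lt_of_le_of_lt ?_ (hN m hm n hn)⟩
  rw [dist_eq_norm, Real.dist_eq]
  refine (norm_exp_sub_exp_apply_le (isPositive_shiftInv hB (reg_pos m))
    (isPositive_shiftInv hB (reg_pos n)) (commute_shiftInv hB (reg_pos n)
      (commute_shiftInv hB (reg_pos m) (Commute.refl B)).symm) (le_max_right t 0) _).trans ?_
  have h := norm_shiftInv_sub_le hB (reg_pos m) (reg_pos n) y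
  have h0 : (0:ℝ) ≤ max t 0 := le_max_right _ _
  calc _ ≤ |reg n - reg m| * ‖y‖ * max t 0 := by gcongr; exact h
    _ = _ := by
      rw [← mul_sub, abs_mul, abs_sub_comm, abs_of_nonneg (mul_nonneg h0 (norm_nonneg y))]; ring

open Classical in
/-- The semigroup generated by `-B⁻¹` for a positive operator `B` with dense range. -/
def invSemigroup (B : X →L[ℝ] X) (t : ℝ) : X →L[ℝ] X :=
  if h : ∃ f, Tendsto (fun n x => approxExp B n t x) atTop (𝓝 f) then
    continuousLinearMapOfTendsto (approxExp B · t) h.choose_spec else 0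

theorem tendsto_approxExp (hB : B.IsPositive) (hd : DenseRange B) (t : ℝ) (x : X) :
    Tendsto (fun n => approxExp B n t x) atTop (𝓝 (invSemigroup B t x)) := by
  have h : ∃ f, Tendsto (fun n x => approxExp B n t x) atTop (𝓝 f) := by
    choose f hf using fun x => cauchySeq_tendsto_of_complete (cauchySeq_approxExp hB hd t x)
    exact ⟨f, tendsto_pi_nhds.2 hf⟩
  rw [invSemigroup, dif_pos h]
  exact tendsto_pi_nhds.1 h.choose_spec x

theorem norm_invSemigroup_le (hB : B.IsPositive) (hd : DenseRange B) (t : ℝ) (x : X) :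
    ‖invSemigroup B t x‖ ≤ ‖x‖ :=
  le_of_tendsto' (tendsto_approxExp hB hd t x).norm fun n => norm_approxExp_le hB n t x

theorem invSemigroup_of_nonpos (hB : B.IsPositive) (hd : DenseRange B) {t : ℝ} (ht : t ≤ 0)
    (x : X) : invSemigroup B t x = x := by
  refine tendsto_nhds_unique (tendsto_approxExp hB hd t x) ?_
  simp [approxExp, max_eq_right ht]

theorem invSemigroup_add (hB : B.IsPositive) (hd : DenseRange B) {s t : ℝ} (hs : 0 ≤ s)
    (ht : 0 ≤ t) (x : X) :
    invSemigroup B (s + t) x = invSemigroup B s (invSemigroup B t x) := by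
  refine tendsto_nhds_unique (tendsto_approxExp hB hd (s + t) x) ?_
  have h : ∀ n, approxExp B n (s + t) x = approxExp B n s (invSemigroup B t x) +
      approxExp B n s (approxExp B n t x - invSemigroup B t x) := fun n => by
    rw [← map_add, add_sub_cancel, approxExp, max_eq_left (add_nonneg hs ht), exp_add_smul,
      approxExp, approxExp, max_eq_left hs, max_eq_left ht]
    rfl
  simp only [h]
  have h2 : Tendsto (fun n => approxExp B n s (approxExp B n t x - invSemigroup B t x)) atTop
      (𝓝 0) := by
    refine squeeze_zero_norm (fun n => norm_approxExp_le hB n s _) ?_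
    exact tendsto_iff_norm_sub_tendsto_zero.1 (tendsto_approxExp hB hd t x)
  simpa using (tendsto_approxExp hB hd s (invSemigroup B t x)).add h2

theorem invSemigroup_inner (hB : B.IsPositive) (hd : DenseRange B) (t : ℝ) (x y : X) :
    ⟪invSemigroup B t x, y⟫_ℝ = ⟪x, invSemigroup B t y⟫_ℝ := by
  refine tendsto_nhds_unique ((tendsto_approxExp hB hd t x).inner tendsto_const_nhds) ?_
  have h : ∀ n, ⟪approxExp B n t x, y⟫_ℝ = ⟪x, approxExp B n t y⟫_ℝ := fun n => by
    have h1 : IsSelfAdjoint (shiftInv B (reg n)) :=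
      (isPositive_shiftInv hB (reg_pos n)).isSelfAdjoint
    have h2 : IsSelfAdjoint (approxExp B n t) := by
      rw [approxExp, smul_neg, ← neg_smul]
      refine IsSelfAdjoint.exp ?_
      rw [isSelfAdjoint_iff, star_smul, h1.star_eq, star_trivial]
    exact h2.isSymmetric x y
  simp only [h]
  exact tendsto_const_nhds.inner (tendsto_approxExp hB hd t y)

theorem apply_invSemigroup (hB : B.IsPositive) (hd : DenseRange B) (t : ℝ) (x : X) :
    B (invSemigroup B t x) = invSemigroup B t (B x) := by
  refine tendsto_nhds_unique ((B.continuous.tendsto _).comp (tendsto_approxExp hB hd t x)) ?_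
  have h : ∀ n, B (approxExp B n t x) = approxExp B n t (B x) := fun n =>
    congrArg (fun P : X →L[ℝ] X => P x) (Commute.exp_right
      ((commute_shiftInv hB (reg_pos n) (Commute.refl B)).neg_right.smul_right (max t 0))).eq
  simp only [Function.comp_def, h]
  exact tendsto_approxExp hB hd t (B x)

/-- Applying `B + l` cancels the inverse that differentiation produces, leaving a derivative that
stays bounded as `l → 0`. -/
theorem hasDerivAt_shift_exp (hB : B.IsPositive) (n : ℕ) (x : X) (t : ℝ) :
    HasDerivAt (fun s : ℝ => (B + reg n • 1) (NormedSpace.exp (s • (-shiftInv B (reg n))) x))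
      (-NormedSpace.exp (t • (-shiftInv B (reg n))) x) t := by
  have h := (B + reg n • (1 : X →L[ℝ] X)).hasFDerivAt.comp_hasDerivAt t
    (hasDerivAt_exp_smul_apply (-shiftInv B (reg n)) x t)
  have e := apply_shiftInv hB (reg_pos n) (NormedSpace.exp (t • (-shiftInv B (reg n))) x)
  have e2 : (B + reg n • (1 : X →L[ℝ] X)) ((-shiftInv B (reg n))
      (NormedSpace.exp (t • (-shiftInv B (reg n))) x)) =
      -NormedSpace.exp (t • (-shiftInv B (reg n))) x := by
    rw [neg_apply, map_neg]
    exact congrArg Neg.neg e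
  rw [← e2]
  exact h

/-- Integrated form of `d/dt S(t) x = -B⁻¹ S(t) x`. -/
theorem apply_invSemigroup_sub (hB : B.IsPositive) (hd : DenseRange B) {s t : ℝ} (hs : 0 ≤ s)
    (hst : s ≤ t) (x : X) :
    B (invSemigroup B s x - invSemigroup B t x) = ∫ r in s..t, invSemigroup B r x := by
  have h1 : ∀ n, (B + reg n • 1) (approxExp B n s x) - (B + reg n • 1) (approxExp B n t x) =
      ∫ r in s..t, approxExp B n r x := fun n => by
    have hc : Continuous fun r : ℝ => NormedSpace.exp (r • (-shiftInv B (reg n))) x :=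
      continuous_iff_continuousAt.2 fun t => (hasDerivAt_exp_smul_apply _ x t).continuousAt
    have h := intervalIntegral.integral_eq_sub_of_hasDerivAt (a := s) (b := t)
      (fun r _ => hasDerivAt_shift_exp hB n x r) (hc.neg.intervalIntegrable _ _)
    have e : ∀ r, 0 ≤ r → approxExp B n r = NormedSpace.exp (r • (-shiftInv B (reg n))) :=
      fun r hr => by rw [approxExp, max_eq_left hr]
    rw [intervalIntegral.integral_neg] at h
    rw [e s hs, e t (hs.trans hst), ← neg_inj, neg_sub, ← h, neg_inj]
    refine intervalIntegral.integral_congr fun r hr => ?_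
    rw [uIcc_of_le hst] at hr
    simp only [e r (hs.trans hr.1)]
  have h2 : Tendsto (fun n => ∫ r in s..t, approxExp B n r x) atTop
      (𝓝 (∫ r in s..t, invSemigroup B r x)) := by
    refine intervalIntegral.tendsto_integral_filter_of_dominated_convergence (fun _ => ‖x‖)
      (Eventually.of_forall fun n => (continuous_approxExp B n x).aestronglyMeasurable)
      (Eventually.of_forall fun n => Eventually.of_forall fun r _ => norm_approxExp_le hB n r x)
      intervalIntegrable_const (Eventually.of_forall fun r _ => tendsto_approxExp hB hd r x)
  have h3 : ∀ t, Tendsto (fun n => (B + reg n • 1) (approxExp B n t x)) atTop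
      (𝓝 (B (invSemigroup B t x))) := fun t => by
    have := ((B.continuous.tendsto _).comp (tendsto_approxExp hB hd t x)).add
      (tendsto_reg.smul (tendsto_approxExp hB hd t x))
    simpa using this
  rw [map_sub]
  refine tendsto_nhds_unique ((h3 s).sub (h3 t)) ?_
  simpa only [h1] using h2

theorem invSemigroup_max (hB : B.IsPositive) (hd : DenseRange B) (t : ℝ) :
    invSemigroup B (max t 0) = invSemigroup B t := by
  ext x
  rcases le_total t 0 with h | h
  · rw [max_eq_right h, invSemigroup_of_nonpos hB hd h, invSemigroup_of_nonpos hB hd le_rfl]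
  · rw [max_eq_left h]

theorem norm_invSemigroup_sub_le (hB : B.IsPositive) (hd : DenseRange B) (s t : ℝ) (x : X) :
    ‖invSemigroup B s (B x) - invSemigroup B t (B x)‖ ≤ ‖x‖ * |s - t| := by
  have key : ∀ s t, 0 ≤ s → s ≤ t →
      ‖invSemigroup B s (B x) - invSemigroup B t (B x)‖ ≤ ‖x‖ * |s - t| := fun s t hs hst => by
    rw [← apply_invSemigroup hB hd, ← apply_invSemigroup hB hd, ← map_sub,
      apply_invSemigroup_sub hB hd hs hst, abs_sub_comm]
    exact intervalIntegral.norm_integral_le_of_norm_le_const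
      fun r _ => norm_invSemigroup_le hB hd r x
  -- The orbit is constant on negative times and `max · 0` is 1-Lipschitz, so nonnegative times
  -- suffice.
  rw [← invSemigroup_max hB hd s, ← invSemigroup_max hB hd t]
  have h : ‖invSemigroup B (max s 0) (B x) - invSemigroup B (max t 0) (B x)‖ ≤
      ‖x‖ * |max s 0 - max t 0| := by
    rcases le_total (max s 0) (max t 0) with h | h
    · exact key _ _ (le_max_right _ _) h
    · rw [norm_sub_rev, abs_sub_comm]
      exact key _ _ (le_max_right _ _) h
  refine h.trans ?_
  exact mul_le_mul_of_nonneg_left (abs_max_sub_max_le_abs s t 0) (norm_nonneg x)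

/-- Orbits starting in the range of `B` are Lipschitz, and by contractivity every orbit is a uniform
limit of those. -/
theorem continuous_invSemigroup (hB : B.IsPositive) (hd : DenseRange B) (x : X) :
    Continuous fun t => invSemigroup B t x := by
  refine continuous_of_uniform_approx_of_continuous fun u hu => ?_
  obtain ⟨ε, hε, hu⟩ := Metric.mem_uniformity_dist.1 hu
  obtain ⟨_, hy, y, rfl⟩ := Metric.dense_iff.1 hd x ε hε
  refine ⟨fun t => invSemigroup B t (B y), ?_, fun t => ?_⟩
  · refine (LipschitzWith.of_dist_le_mul (K := ‖y‖₊) fun s t => ?_).continuous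
    rw [dist_eq_norm, Real.dist_eq]
    exact norm_invSemigroup_sub_le hB hd s t y
  · refine hu ?_
    rw [dist_eq_norm, ← map_sub]
    refine (norm_invSemigroup_le hB hd t _).trans_lt ?_
    rw [← dist_eq_norm, dist_comm]
    exact hy

/-- By the integrated equation, `B` maps the difference quotient of `z` to minus the mean of its
orbit over `[0,t]`, which tends to `-z`. One direction applies `B` to the limit; in the other, `x =
-B y` turns the quotient itself into the mean of the orbit of `y`. -/
theorem tendsto_invSemigroup_quotient_iff (hB : B.IsPositive) (hd : DenseRange B) (x y : X) :
    Tendsto (fun t : ℝ => t⁻¹ • (invSemigroup B t x - x)) (𝓝[>] 0) (𝓝 y) ↔ x = -B y := by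
  have hF : ∀ z, Tendsto (fun t : ℝ => t⁻¹ • ∫ r in (0:ℝ)..t, invSemigroup B r z) (𝓝[>] 0)
      (𝓝 z) := fun z => by
    have h := intervalIntegral.integral_hasDerivAt_right (a := 0) (b := 0)
      ((continuous_invSemigroup hB hd z).intervalIntegrable _ _)
      ((continuous_invSemigroup hB hd z).stronglyMeasurableAtFilter _ _)
      (continuous_invSemigroup hB hd z).continuousAt
    rw [invSemigroup_of_nonpos hB hd le_rfl] at h
    have h2 := h.tendsto_slope_zero_right
    simpa using h2
  have hK : ∀ t ≥ 0, ∀ z, B (invSemigroup B t z - z) = -∫ r in (0:ℝ)..t, invSemigroup B r z :=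
    fun t ht z => by
      rw [← apply_invSemigroup_sub hB hd le_rfl ht, invSemigroup_of_nonpos hB hd le_rfl, ← map_neg,
        neg_sub]
  constructor
  · intro h
    have h1 := (B.continuous.tendsto _).comp h
    refine neg_injective ?_
    rw [neg_neg]
    refine tendsto_nhds_unique (hF x).neg (h1.congr' ?_)
    filter_upwards [self_mem_nhdsWithin] with t ht
    simp only [Function.comp_apply]
    rw [map_smul, hK t (le_of_lt ht), smul_neg]
  · rintro rfl
    refine (hF y).congr' ?_
    filter_upwards [self_mem_nhdsWithin] with t ht
    rw [← neg_neg (∫ r in (0:ℝ)..t, invSemigroup B r y), ← hK t (le_of_lt ht), map_neg,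
      ← apply_invSemigroup hB hd, map_sub]
    congr 1; abel

omit [CompleteSpace X] in
-- Apply `S s` to the difference quotient at `0`. By the semigroup law the result is the quotient of
-- the orbit at `s`, and also the quotient at `0` of the vector `S s (-B y)`; reading the generator
-- hypothesis backwards on the latter gives the commutation.
theorem semigroup_hasDerivWithinAt {S : ℝ → X →L[ℝ] X}
    (hadd : ∀ s t, 0 ≤ s → 0 ≤ t → S (s + t) = S s ∘L S t)
    (hgen : ∀ x y, Tendsto (fun t : ℝ => t⁻¹ • (S t x - x)) (𝓝[>] 0) (𝓝 y) ↔ x = -B y)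
    (y : X) {s : ℝ} (hs : 0 ≤ s) :
    HasDerivWithinAt (fun r => S r (-B y)) (S s y) (Ici s) s ∧ S s (-B y) = -B (S s y) := by
  have h := (((S s).continuous.tendsto _).comp ((hgen (-B y) y).2 rfl))
  constructor
  · rw [← hasDerivWithinAt_Ioi_iff_Ici, hasDerivWithinAt_iff_tendsto_slope' self_notMem_Ioi]
    have h1 : Tendsto (fun r => r - s) (𝓝[>] s) (𝓝[>] 0) := by
      refine tendsto_nhdsWithin_iff.2 ⟨?_, ?_⟩
      · have : Tendsto (fun r => r - s) (𝓝 s) (𝓝 (s - s)) :=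
          (continuous_id.sub continuous_const).tendsto s
        rw [sub_self] at this
        exact this.mono_left nhdsWithin_le_nhds
      · filter_upwards [self_mem_nhdsWithin] with r hr
        exact sub_pos.2 (show s < r from hr)
    refine (h.comp h1).congr' ?_
    filter_upwards [self_mem_nhdsWithin] with r hr
    have e : S r = S s ∘L S (r - s) := by
      rw [← hadd s (r - s) hs (sub_nonneg.2 (le_of_lt hr)), add_sub_cancel]
    simp only [Function.comp_apply, slope_def_module, map_smul]
    rw [e, map_sub]; rfl
  · refine (hgen _ _).1 (h.congr' ?_)
    filter_upwards [self_mem_nhdsWithin] with r hr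
    have e : S s (S r (-B y)) = S r (S s (-B y)) := by
      have h1 := hadd s r hs (le_of_lt hr)
      rw [add_comm, hadd r s (le_of_lt hr) hs] at h1
      exact congrArg (fun P : X →L[ℝ] X => P (-B y)) h1.symm
    simp only [Function.comp_apply, map_smul]
    rw [map_sub, e]

/-- A strongly continuous semigroup is determined by its generator `-B⁻¹`. -/
theorem eq_invSemigroup (hB : B.IsPositive) (hd : DenseRange B)
    {S : ℝ → X →L[ℝ] X} (h0 : S 0 = ContinuousLinearMap.id ℝ X)
    (hadd : ∀ s t, 0 ≤ s → 0 ≤ t → S (s + t) = S s ∘L S t)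
    (hc : ∀ x, ContinuousOn (fun t => S t x) (Ici 0))
    (hgen : ∀ x y, Tendsto (fun t : ℝ => t⁻¹ • (S t x - x)) (𝓝[>] 0) (𝓝 y) ↔ x = -B y)
    {t : ℝ} (ht : 0 ≤ t) : S t = invSemigroup B t := by
  have hfun : (S t : X → X) = invSemigroup B t := by
    refine hd.equalizer (S t).continuous (invSemigroup B t).continuous (funext fun y => ?_)
    -- The argument `-y` gives `-B (-y) = B y`, a general element of the dense range.
    have hS := fun s (hs : 0 ≤ s) => semigroup_hasDerivWithinAt hadd hgen (-y) hs
    have hI := fun s (hs : 0 ≤ s) => semigroup_hasDerivWithinAt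
      (fun s t hs ht => ContinuousLinearMap.ext (invSemigroup_add hB hd hs ht))
      (tendsto_invSemigroup_quotient_iff hB hd) (-y) hs
    simp only [map_neg, neg_neg] at hS hI
    have h := norm_le_of_inner_deriv_nonpos
      (w := fun s => S s (B y) - invSemigroup B s (B y)) ht
      (((hc (B y)).mono Icc_subset_Ici_self).sub
        (continuous_invSemigroup hB hd (B y)).continuousOn)
      (fun s hs => (hS s hs.1).1.sub (hI s hs.1).1) (fun s hs => by
        -- With `e` the difference of the two orbits of `y`, the curve is `B e` and its derivative
        -- is `-e`, so the inner product is `-⟪B e, e⟫ ≤ 0`.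
        rw [(hS s hs.1).2, (hI s hs.1).2, ← map_sub]
        have := hB.inner_nonneg_left (S s y - invSemigroup B s y)
        rw [show -S s y - -invSemigroup B s y = -(S s y - invSemigroup B s y) by abel,
          inner_neg_right]
        linarith)
    rw [h0, invSemigroup_of_nonpos hB hd le_rfl] at h
    simp only [ContinuousLinearMap.id_apply, sub_self, norm_zero] at h
    exact sub_eq_zero.1 (norm_le_zero_iff.1 h)
  exact DFunLike.coe_injective hfun

end Semigroup

/-! ### The energy identity for primitives with values in the range of `E†E`. -/

section EnergyIdentity

variable {X Y : Type*} [NormedAddCommGroup X] [InnerProductSpace ℝ X] [CompleteSpace X]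
  [NormedAddCommGroup Y] [InnerProductSpace ℝ Y] [CompleteSpace Y]

/-- The product rule for the quadratic form `⟪K F, F⟫` of a primitive `F(t) = ∫₀ᵗ f`. -/
theorem inner_apply_primitive {K : X →L[ℝ] X} (hK : ∀ x y, ⟪K x, y⟫_ℝ = ⟪x, K y⟫_ℝ) {T : ℝ}
    {f : ℝ → X} (hf : IntegrableOn f (Ioc 0 T)) :
    ⟪K (∫ s in Ioc 0 T, f s), ∫ s in Ioc 0 T, f s⟫_ℝ =
      2 * ∫ t in Ioc 0 T, ⟪K (∫ s in Ioc 0 t, f s), f t⟫_ℝ := by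
  set μ := volume.restrict (Ioc 0 T) with hμ
  have hfμ : Integrable f μ := hf
  let g : ℝ × ℝ → ℝ := fun p => ⟪K (f p.1), f p.2⟫_ℝ
  have hg : Integrable g (μ.prod μ) := by
    refine Integrable.mono' (g := fun p : ℝ × ℝ => ‖K (f p.1)‖ * ‖f p.2‖)
      ((K.integrable_comp hfμ).norm.mul_prod hfμ.norm) ?_
      (Eventually.of_forall fun p => norm_inner_le_norm _ _)
    exact ((K.integrable_comp hfμ).aestronglyMeasurable.comp_fst).inner
      hfμ.aestronglyMeasurable.comp_snd
  -- Split the square along the diagonal. Symmetry of `K` makes both halves contribute the same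
  -- integral, hence the factor `2`.
  have hm : MeasurableSet {p : ℝ × ℝ | p.1 ≤ p.2} := measurableSet_le measurable_fst measurable_snd
  have e1 : ∀ s, ∫ r, g (r, s) ∂μ = ⟪K (∫ r, f r ∂μ), f s⟫_ℝ := fun s => by
    simp only [g]
    rw [← K.integral_comp_comm hfμ, real_inner_comm, ← integral_inner (K.integrable_comp hfμ)]
    simp only [real_inner_comm]
  have e0 : ∫ p, g p ∂(μ.prod μ) = ⟪K (∫ r, f r ∂μ), ∫ r, f r ∂μ⟫_ℝ := by
    rw [integral_prod_symm _ hg]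
    simp only [e1]
    rw [integral_inner hfμ]
  have e2 : ∫ p in {p : ℝ × ℝ | p.1 ≤ p.2}, g p ∂(μ.prod μ) =
      ∫ t in Ioc 0 T, ⟪K (∫ s in Ioc 0 t, f s), f t⟫_ℝ := by
    rw [← integral_indicator hm, integral_prod_symm _ (hg.indicator hm)]
    refine setIntegral_congr_fun measurableSet_Ioc fun t ht => ?_
    have hI : IntegrableOn f (Ioc 0 t) := hf.mono_set (Ioc_subset_Ioc_right ht.2)
    have : (fun r => {p : ℝ × ℝ | p.1 ≤ p.2}.indicator g (r, t)) =
        (Iic t).indicator fun r => g (r, t) := by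
      ext r; simp [indicator]
    simp only [this]
    rw [integral_indicator measurableSet_Iic, hμ, Measure.restrict_restrict measurableSet_Iic,
      inter_comm, Ioc_inter_Iic, inf_eq_right.2 ht.2, ← K.integral_comp_comm hI, real_inner_comm,
      ← integral_inner (K.integrable_comp hI)]
    simp only [g, real_inner_comm]
  have e3 : ∫ p in {p : ℝ × ℝ | p.1 ≤ p.2}ᶜ, g p ∂(μ.prod μ) =
      ∫ t in Ioc 0 T, ⟪K (∫ s in Ioc 0 t, f s), f t⟫_ℝ := by
    rw [← integral_indicator hm.compl, integral_prod _ (hg.indicator hm.compl)]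
    refine setIntegral_congr_fun measurableSet_Ioc fun t ht => ?_
    have hI : IntegrableOn f (Ioc 0 t) := hf.mono_set (Ioc_subset_Ioc_right ht.2)
    have : (fun s => {p : ℝ × ℝ | p.1 ≤ p.2}ᶜ.indicator g (t, s)) =
        (Iio t).indicator fun s => g (t, s) := by
      ext r; simp [indicator]
    have hset : Ioc 0 T ∩ Iio t = Ioo 0 t := by
      ext r; simp only [mem_inter_iff, mem_Ioc, mem_Iio, mem_Ioo]
      exact ⟨fun h => ⟨h.1.1, h.2⟩, fun h => ⟨⟨h.1, h.2.le.trans ht.2⟩, h.2⟩⟩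
    simp only [this]
    rw [integral_indicator measurableSet_Iio, hμ, Measure.restrict_restrict measurableSet_Iio,
      inter_comm, hset, ← integral_Ioc_eq_integral_Ioo, hK, real_inner_comm,
      ← integral_inner hI]
  have e4 := integral_add_compl hm hg
  rw [e0, e2, e3] at e4
  linarith

variable {E : X →L[ℝ] Y}

/-- Pair `(E†E + l) w = E† y` with `w` to get `‖E w‖² + l ‖w‖² = ⟪y, E w⟫`, then use Cauchy–Schwarz.
-/
theorem norm_apply_shiftInv_adjoint_le (E : X →L[ℝ] Y) {l : ℝ} (hl : 0 < l) (y : Y) :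
    ‖E (shiftInv (E.adjoint ∘L E) l (E.adjoint y))‖ ≤ ‖y‖ := by
  set w := shiftInv (E.adjoint ∘L E) l (E.adjoint y) with hw
  have h := apply_shiftInv (ContinuousLinearMap.isPositive_adjoint_comp_self E) hl (E.adjoint y)
  rw [← hw] at h
  have h1 : ⟪E w, E w⟫_ℝ + l * ⟪w, w⟫_ℝ = ⟪y, E w⟫_ℝ := by
    rw [← ContinuousLinearMap.adjoint_inner_left E w y]
    conv_rhs => rw [← h]
    rw [inner_add_left, real_inner_smul_left, ContinuousLinearMap.comp_apply,
      ContinuousLinearMap.adjoint_inner_left]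
  rw [real_inner_self_eq_norm_sq, real_inner_self_eq_norm_sq] at h1
  have h2 := real_inner_le_norm y (E w)
  have h3 : 0 ≤ l * ‖w‖ ^ 2 := by positivity
  by_contra hc
  push Not at hc
  nlinarith [norm_nonneg y]

theorem tendsto_apply_shiftInv_adjoint (hE : DenseRange E) (hE' : DenseRange E.adjoint) (y : Y) :
    Tendsto (fun n => E (shiftInv (E.adjoint ∘L E) (reg n) (E.adjoint y))) atTop (𝓝 y) := by
  have hd : DenseRange (E.adjoint ∘L E) := hE'.comp hE E.adjoint.continuous
  have hB := ContinuousLinearMap.isPositive_adjoint_comp_self E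
  refine tendsto_of_dense
    (L := fun n => E ∘L shiftInv (E.adjoint ∘L E) (reg n) ∘L E.adjoint)
    (G := ContinuousLinearMap.id ℝ Y)
    (fun n y => norm_apply_shiftInv_adjoint_le E (reg_pos n) y) (fun x => le_rfl) hE ?_ y
  rintro _ ⟨x, rfl⟩
  have h := (E.continuous.tendsto _).comp (tendsto_apply_shiftInv hB hd x)
  refine h.congr fun n => ?_
  simp only [Function.comp_apply]
  rw [shiftInv_comm hB (reg_pos n)]
  rfl

/-- Write `R = (B + l)⁻¹` and `F` for the primitive. The left side is the quadratic form of `R B R`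
at `F(T)`, so the product rule applies; as `F = B z` almost everywhere, the integrand becomes `⟪B R
B R z, f⟫`. It is dominated by `‖z‖ ‖f‖` and tends to `⟪z, f⟫`, since `B R` is a contraction
converging strongly to the identity. -/
theorem tendsto_norm_sq_primitive (hE : DenseRange E) (hE' : DenseRange E.adjoint) {T : ℝ}
    {z f : ℝ → X} (hz : MemLp z 2 (volume.restrict (Ioc 0 T)))
    (hf : MemLp f 2 (volume.restrict (Ioc 0 T)))
    (h : ∀ᵐ t ∂volume.restrict (Ioc 0 T), E.adjoint (E (z t)) = ∫ s in Ioc 0 t, f s) :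
    Tendsto (fun n => ‖E (shiftInv (E.adjoint ∘L E) (reg n) (∫ s in Ioc 0 T, f s))‖ ^ 2) atTop
      (𝓝 (2 * ∫ t in Ioc 0 T, ⟪z t, f t⟫_ℝ)) := by
  set B := E.adjoint ∘L E with hBdef
  have hd : DenseRange B := hE'.comp hE E.adjoint.continuous
  have hB : B.IsPositive := ContinuousLinearMap.isPositive_adjoint_comp_self E
  have hfi : IntegrableOn f (Ioc 0 T) := hf.integrable (by norm_num)
  have e : ∀ n, ‖E (shiftInv B (reg n) (∫ s in Ioc 0 T, f s))‖ ^ 2 =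
      2 * ∫ t in Ioc 0 T, ⟪B (shiftInv B (reg n) (B (shiftInv B (reg n) (z t)))), f t⟫_ℝ :=
    fun n => by
      have hs := shiftInv_inner hB (reg_pos n)
      have hBs : ∀ x y, ⟪B x, y⟫_ℝ = ⟪x, B y⟫_ℝ := fun x y => hB.isSymmetric x y
      have h1 := inner_apply_primitive
        (K := shiftInv B (reg n) ∘L B ∘L shiftInv B (reg n))
        (fun x y => by simp only [ContinuousLinearMap.comp_apply, hs, hBs]) hfi
      rw [← real_inner_self_eq_norm_sq, ← ContinuousLinearMap.adjoint_inner_left]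
      simp only [ContinuousLinearMap.comp_apply, hs] at h1
      refine h1.trans ?_
      congr 1
      refine integral_congr_ae ?_
      filter_upwards [h] with t ht
      rw [← ht, ← hs]
      change ⟪shiftInv B (reg n) (B (shiftInv B (reg n) (B (z t)))), f t⟫_ℝ = _
      rw [← shiftInv_comm hB (reg_pos n) (z t),
        ← shiftInv_comm hB (reg_pos n) (B (shiftInv B (reg n) (z t)))]
  simp only [e]
  refine Tendsto.const_mul 2 ?_
  refine tendsto_integral_of_dominated_convergence (fun t => ‖z t‖ * ‖f t‖) (fun n => ?_)
    (hz.norm.integrable_mul hf.norm) (fun n => Eventually.of_forall fun t => ?_)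
    (Eventually.of_forall fun t => ?_)
  · exact ((B ∘L shiftInv B (reg n) ∘L B ∘L shiftInv B (reg n)).continuous.comp_aestronglyMeasurable
      hz.1).inner hf.1
  · refine (norm_inner_le_norm _ _).trans ?_
    gcongr
    exact (norm_apply_shiftInv_le hB (reg_pos n) _).trans (norm_apply_shiftInv_le hB (reg_pos n) _)
  · refine Tendsto.inner ?_ tendsto_const_nhds
    have h1 := tendsto_apply_shiftInv hB hd (z t)
    have h2 : Tendsto (fun n => B (shiftInv B (reg n) (B (shiftInv B (reg n) (z t)) - z t))) atTop
        (𝓝 0) := squeeze_zero_norm (fun n => norm_apply_shiftInv_le hB (reg_pos n) _)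
          (tendsto_iff_norm_sub_tendsto_zero.1 h1)
    simpa using h2.add h1

/-- A vector whose inner products are controlled by `‖E ·‖` is in the range of the adjoint. -/
theorem exists_adjoint_eq (hE : DenseRange E) {x : X} {C : ℝ}
    (h : ∀ ζ, ‖⟪x, ζ⟫_ℝ‖ ≤ C * ‖E ζ‖) : ∃ y, E.adjoint y = x := by
  -- The bound makes `E ζ ↦ ⟪x, ζ⟫` well defined and bounded on a dense subspace; its extension has
  -- a Riesz representative.
  let φ := ((innerSL ℝ x : X →L[ℝ] ℝ) : X →ₗ[ℝ] ℝ).extendOfNorm (E : X →ₗ[ℝ] Y)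
  refine ⟨(InnerProductSpace.toDual ℝ Y).symm φ, ext_inner_right ℝ fun ζ => ?_⟩
  rw [ContinuousLinearMap.adjoint_inner_left, InnerProductSpace.toDual_symm_apply]
  exact LinearMap.extendOfNorm_eq hE ⟨C, h⟩ ζ

/-- A primitive of `f` whose values lie a.e. in the range of `E† E`, square integrably, has its final
value in the range of `E†`. -/
theorem exists_adjoint_eq_primitive (hE : DenseRange E) (hE' : DenseRange E.adjoint) {T : ℝ}
    {z f : ℝ → X} (hz : MemLp z 2 (volume.restrict (Ioc 0 T)))
    (hf : MemLp f 2 (volume.restrict (Ioc 0 T)))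
    (h : ∀ᵐ t ∂volume.restrict (Ioc 0 T), E.adjoint (E (z t)) = ∫ s in Ioc 0 t, f s) :
    ∃ y, E.adjoint y = ∫ s in Ioc 0 T, f s := by
  have hB := ContinuousLinearMap.isPositive_adjoint_comp_self E
  have hd : DenseRange (E.adjoint ∘L E) := hE'.comp hE E.adjoint.continuous
  have h1 := (Real.continuous_sqrt.tendsto _).comp (tendsto_norm_sq_primitive hE hE' hz hf h)
  refine exists_adjoint_eq (C := √(2 * ∫ t in Ioc 0 T, ⟪z t, f t⟫_ℝ)) hE fun ζ => ?_
  -- Pass to the limit in `|⟪E†E R F(T), ζ⟫| ≤ ‖E R F(T)‖ ‖E ζ‖`, where `R` is the regularized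
  -- inverse and `F(T)` the final value of the primitive.
  refine le_of_tendsto_of_tendsto' (((tendsto_apply_shiftInv hB hd _).inner
    tendsto_const_nhds).norm) (h1.mul_const ‖E ζ‖) fun n => ?_
  simp only [Function.comp_apply]
  rw [Real.sqrt_sq (norm_nonneg _), ContinuousLinearMap.comp_apply,
    ContinuousLinearMap.adjoint_inner_left]
  exact norm_inner_le_norm _ _

theorem norm_sq_eq_of_adjoint_eq_primitive (hE : DenseRange E) (hE' : DenseRange E.adjoint) {T : ℝ}
    {z f : ℝ → X} (hz : MemLp z 2 (volume.restrict (Ioc 0 T)))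
    (hf : MemLp f 2 (volume.restrict (Ioc 0 T)))
    (h : ∀ᵐ t ∂volume.restrict (Ioc 0 T), E.adjoint (E (z t)) = ∫ s in Ioc 0 t, f s)
    {y : Y} (hy : E.adjoint y = ∫ s in Ioc 0 T, f s) :
    ‖y‖ ^ 2 = 2 * ∫ t in Ioc 0 T, ⟪z t, f t⟫_ℝ := by
  have h1 := tendsto_norm_sq_primitive hE hE' hz hf h
  rw [← hy] at h1
  exact tendsto_nhds_unique ((tendsto_apply_shiftInv_adjoint hE hE' y).norm.pow 2) h1

end EnergyIdentity

/-! ### Duhamel integrals and step functions in time. -/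

section Duhamel

/-- Subtracting tails shows that the primitive from `0` vanishes identically; Lebesgue
differentiation then recovers `f`. -/
theorem eq_zero_of_setIntegral_Ioc {X : Type*} [NormedAddCommGroup X] [NormedSpace ℝ X]
    [CompleteSpace X] {T : ℝ} {f : ℝ → X} (hf : IntegrableOn f (Ioc 0 T))
    (h : ∀ a ∈ Icc 0 T, ∫ s in Ioc a T, f s = 0) :
    f =ᵐ[volume.restrict (Ioc 0 T)] 0 := by
  rcases le_total T 0 with hT | hT
  · rw [Ioc_eq_empty (not_lt.2 hT), Measure.restrict_empty, EventuallyEq, ae_zero]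
    exact Filter.eventually_bot
  have hi : IntervalIntegrable f volume 0 T := (intervalIntegrable_iff_integrableOn_Ioc_of_le hT).2 hf
  rw [EventuallyEq, ← restrict_Ioo_eq_restrict_Ioc, ae_restrict_iff' measurableSet_Ioo]
  filter_upwards [hi.ae_hasDerivAt_integral] with t ht htT
  rw [uIcc_of_le hT] at ht
  have h1 := ht ⟨htT.1.le, htT.2.le⟩ 0 ⟨le_rfl, hT⟩
  have h2 : (fun x => ∫ s in (0:ℝ)..x, f s) =ᶠ[𝓝 t] fun _ => 0 := by
    filter_upwards [Ioo_mem_nhds htT.1 htT.2] with x hx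
    have h2 := h 0 ⟨le_rfl, hT⟩
    rw [intervalIntegral.integral_of_le hx.1.le]
    rwa [← Ioc_union_Ioc_eq_Ioc hx.1.le hx.2.le, setIntegral_union (Ioc_disjoint_Ioc_of_le le_rfl)
      measurableSet_Ioc (hf.mono_set (Ioc_subset_Ioc_right hx.2.le))
      (hf.mono_set (Ioc_subset_Ioc_left hx.1.le)), h x ⟨hx.1.le, hx.2.le⟩, add_zero] at h2
  exact h1.unique ((hasDerivAt_const t (0:X)).congr_of_eventuallyEq h2)

variable {X : Type} [NormedAddCommGroup X] [InnerProductSpace ℝ X] [CompleteSpace X]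
  {B : X →L[ℝ] X}

/-- The function `t ↦ 1_{(a,T]}(t) x`. -/
def stepFn (T a : ℝ) (x : X) : L2Time T X :=
  indicatorConstLp 2 (measurableSet_Ioc (a := a) (b := T))
    (measure_ne_top (volume.restrict (Ioc 0 T)) _) x

omit [InnerProductSpace ℝ X] [CompleteSpace X] in
theorem stepFn_ae_eq (T a : ℝ) (x : X) :
    stepFn T a x =ᵐ[volume.restrict (Ioc 0 T)] (Ioi a).indicator fun _ => x := by
  filter_upwards [indicatorConstLp_coeFn (p := 2) (hs := measurableSet_Ioc (a := a) (b := T))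
    (hμs := measure_ne_top (volume.restrict (Ioc 0 T)) _) (c := x),
    ae_restrict_mem measurableSet_Ioc] with t ht htT
  refine ht.trans ?_
  by_cases h : a < t <;> simp [indicator, h, htT.2]

/-- The functions `1_{(a,T]} x` are total in `L²(0,T;X)`. -/
theorem eq_zero_of_inner_stepFn {T : ℝ} {p : L2Time T X}
    (h : ∀ a ∈ Icc 0 T, ∀ x, ⟪stepFn T a x, p⟫_ℝ = 0) : p = 0 := by
  have hp : IntegrableOn p (Ioc 0 T) := (Lp.memLp p).integrable (by norm_num)
  refine (Lp.eq_zero_iff_ae_eq_zero).2 (eq_zero_of_setIntegral_Ioc hp fun a ha => ?_)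
  refine ext_inner_left ℝ fun x => ?_
  have h1 := h a ha x
  rw [stepFn, L2.inner_indicatorConstLp_eq_inner_setIntegral,
    Measure.restrict_restrict measurableSet_Ioc, inter_eq_left.2 (Ioc_subset_Ioc_left ha.1)] at h1
  rw [h1, inner_zero_right]

/-- Joint continuity is what makes `s ↦ S(t - s) v(s)` measurable for a merely measurable `v`. -/
theorem continuous_uncurry_invSemigroup (hB : B.IsPositive) (hd : DenseRange B) :
    Continuous fun p : X × ℝ => invSemigroup B p.2 p.1 :=
  continuous_prod_of_continuous_lipschitzWith _ 1 (fun x => continuous_invSemigroup hB hd x)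
    fun t => LipschitzWith.of_dist_le_mul fun x y => by
      rw [dist_eq_norm, dist_eq_norm, ← map_sub, NNReal.coe_one, one_mul]
      exact norm_invSemigroup_le hB hd t _

theorem aestronglyMeasurable_invSemigroup (hB : B.IsPositive) (hd : DenseRange B) {g : ℝ → ℝ}
    (hg : Continuous g) {v : ℝ → X} {μ : Measure ℝ} (hv : AEStronglyMeasurable v μ) :
    AEStronglyMeasurable (fun s => invSemigroup B (g s) (v s)) μ := by
  have h := (continuous_uncurry_invSemigroup hB hd).comp_aestronglyMeasurable
    (hv.prodMk hg.aestronglyMeasurable)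
  exact h

theorem integrableOn_invSemigroup (hB : B.IsPositive) (hd : DenseRange B) {T t : ℝ} (ht : t ≤ T)
    (v : L2Time T X) : IntegrableOn (fun s => invSemigroup B (t - s) (v s)) (Ioc 0 t) := by
  have hv : IntegrableOn v (Ioc 0 t) :=
    IntegrableOn.mono_set ((Lp.memLp v).integrable (by norm_num)) (Ioc_subset_Ioc_right ht)
  exact hv.norm.mono' (aestronglyMeasurable_invSemigroup hB hd
    (continuous_const.sub continuous_id) hv.aestronglyMeasurable)
    (Eventually.of_forall fun s => norm_invSemigroup_le hB hd _ _)

/-- The function `s ↦ 1_{(0,t]}(s) S(t-s) c`. -/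
theorem exists_inner_duhamel (hB : B.IsPositive) (hd : DenseRange B) {T t : ℝ} (ht : t ≤ T)
    (c : X) : ∃ g : L2Time T X, ∀ v : L2Time T X,
      ⟪c, ∫ s in Ioc 0 t, invSemigroup B (t - s) (v s)⟫_ℝ = ⟪g, v⟫_ℝ := by
  have hg : MemLp ((Ioc 0 t).indicator fun s => invSemigroup B (t - s) c) 2
      (volume.restrict (Ioc 0 T)) := by
    refine MemLp.of_bound (C := ‖c‖) ?_ (Eventually.of_forall fun s => ?_)
    · exact ((continuous_invSemigroup hB hd c).comp
        (continuous_const.sub continuous_id)).aestronglyMeasurable.indicator measurableSet_Ioc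
    · refine (norm_indicator_le_norm_self _ _).trans (norm_invSemigroup_le hB hd _ _)
  refine ⟨hg.toLp _, fun v => ?_⟩
  rw [← integral_inner (integrableOn_invSemigroup hB hd ht v), L2.inner_def]
  have e : (fun s => ⟪hg.toLp _ s, v s⟫_ℝ) =ᵐ[volume.restrict (Ioc 0 T)]
      (Ioc 0 t).indicator fun s => ⟪c, invSemigroup B (t - s) (v s)⟫_ℝ := by
    filter_upwards [hg.coeFn_toLp] with s hs
    rw [hs]
    by_cases h : s ∈ Ioc 0 t
    · rw [indicator_of_mem h, indicator_of_mem h, invSemigroup_inner hB hd]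
    · rw [indicator_of_notMem h, indicator_of_notMem h, inner_zero_left]
  rw [integral_congr_ae e, integral_indicator measurableSet_Ioc,
    Measure.restrict_restrict measurableSet_Ioc, inter_eq_left.2 (Ioc_subset_Ioc_right ht)]

omit [CompleteSpace X] in
-- The upper limit `max a t` makes the interval empty when `t < a`, so both cases share one formula.
theorem setIntegral_indicator_Ioi {a t : ℝ} (ha : 0 ≤ a) (f : ℝ → X) :
    ∫ s in Ioc 0 t, (Ioi a).indicator f s = ∫ s in Ioc a (max a t), f s := by
  rw [setIntegral_indicator measurableSet_Ioi]
  congr 2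
  ext s
  simp only [mem_inter_iff, mem_Ioc, mem_Ioi, le_max_iff]
  constructor
  · rintro ⟨⟨_, h1⟩, h2⟩; exact ⟨h2, Or.inr h1⟩
  · rintro ⟨h1, h2⟩
    rcases h2 with h2 | h2
    · exact absurd h1 (not_lt.2 h2)
    · exact ⟨⟨ha.trans_lt h1, h2⟩, h1⟩

theorem invSemigroup_max_sub (hB : B.IsPositive) (hd : DenseRange B) (a t : ℝ) :
    invSemigroup B (max a t - a) = invSemigroup B (t - a) := by
  rw [← invSemigroup_max hB hd (t - a), ← sub_self a, max_sub_sub_right, max_comm]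

/-- The integrand is the time derivative of the heat flow started by switching on the source `x` at
time `a`. For `t ≤ a` the right side vanishes because the semigroup is the identity at nonpositive
times. -/
theorem setIntegral_indicator_invSemigroup (hB : B.IsPositive) (hd : DenseRange B) {a t : ℝ}
    (ha : 0 ≤ a) (x : X) :
    ∫ s in Ioc 0 t, (Ioi a).indicator (fun s => invSemigroup B (s - a) x) s =
      B (x - invSemigroup B (t - a) x) := by
  rw [setIntegral_indicator_Ioi ha, ← intervalIntegral.integral_of_le (le_max_left _ _),
    intervalIntegral.integral_comp_sub_right (fun r => invSemigroup B r x), sub_self,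
    ← apply_invSemigroup_sub hB hd le_rfl (sub_nonneg.2 (le_max_left _ _)),
    invSemigroup_of_nonpos hB hd le_rfl, invSemigroup_max_sub hB hd]

theorem duhamel_stepFn (hB : B.IsPositive) (hd : DenseRange B) {a t T : ℝ}
    (ha : 0 ≤ a) (ht : t ≤ T) (x : X) :
    ∫ s in Ioc 0 t, invSemigroup B (t - s) (stepFn T a x s) =
      B (x - invSemigroup B (t - a) x) := by
  have e : ∀ᵐ s ∂volume.restrict (Ioc 0 t), invSemigroup B (t - s) (stepFn T a x s) =
      (Ioi a).indicator (fun s => invSemigroup B (t - s) x) s := by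
    filter_upwards [ae_restrict_of_ae_restrict_of_subset (Ioc_subset_Ioc_right ht)
      (stepFn_ae_eq T a x)] with s hs
    rw [hs]
    by_cases h : s ∈ Ioi a
    · rw [indicator_of_mem h, indicator_of_mem h]
    · rw [indicator_of_notMem h, indicator_of_notMem h, map_zero]
  rw [integral_congr_ae e, setIntegral_indicator_Ioi ha]
  rcases le_total a t with h | h
  · rw [max_eq_right h, ← intervalIntegral.integral_of_le h,
      intervalIntegral.integral_comp_sub_left (fun r => invSemigroup B r x), sub_self,
      ← apply_invSemigroup_sub hB hd le_rfl (sub_nonneg.2 h), invSemigroup_of_nonpos hB hd le_rfl]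
  · rw [max_eq_left h, invSemigroup_of_nonpos hB hd (sub_nonpos.2 h)]
    simp

end Duhamel

/-! ### Injectivity of `H¹₀ → L²` and of `L² → H⁻¹`. -/

section Sobolev

variable {d : ℕ} {Ω : BoundedDomain d}

theorem IsTestFunction.continuous_gradient {φ : EuclideanSpace ℝ (Fin d) → ℝ}
    (hφ : IsTestFunction Ω φ) : Continuous (gradient φ) :=
  (InnerProductSpace.toDual ℝ _).symm.continuous.comp (hφ.smooth.continuous_fderiv (by simp))

theorem IsTestFunction.hasCompactSupport_gradient {φ : EuclideanSpace ℝ (Fin d) → ℝ}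
    (hφ : IsTestFunction Ω φ) : HasCompactSupport (gradient φ) :=
  (hφ.compact.fderiv (𝕜 := ℝ)).comp_left
    (g := (InnerProductSpace.toDual ℝ (EuclideanSpace ℝ (Fin d))).symm) (map_zero _)

theorem memLp_two_of_hasCompactSupport {F : Type*} [NormedAddCommGroup F]
    {f : EuclideanSpace ℝ (Fin d) → F} (hc : Continuous f) (hs : HasCompactSupport f) :
    MemLp f 2 (volume.restrict Ω.carrier) :=
  (hc.memLp_of_hasCompactSupport hs).restrict _

theorem integrableOn_of_memLp_two {F : Type*} [NormedAddCommGroup F]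
    {f : EuclideanSpace ℝ (Fin d) → F} (hf : MemLp f 2 (volume.restrict Ω.carrier)) :
    IntegrableOn f Ω.carrier := by
  have : IsFiniteMeasure (volume.restrict Ω.carrier) :=
    isFiniteMeasure_restrict.2 Ω.isBounded.measure_lt_top.ne
  exact hf.integrable (by norm_num)

/-- The fundamental lemma of the calculus of variations. -/
theorem ae_eq_zero_of_integral_testFunction {F : Type*} [NormedAddCommGroup F] [NormedSpace ℝ F]
    [CompleteSpace F] {f : EuclideanSpace ℝ (Fin d) → F}
    (hf : MemLp f 2 (volume.restrict Ω.carrier))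
    (h : ∀ φ, IsTestFunction Ω φ → ∫ x in Ω.carrier, φ x • f x = 0) :
    f =ᵐ[volume.restrict Ω.carrier] 0 := by
  have h1 := Ω.isOpen.ae_eq_zero_of_integral_contDiff_smul_eq_zero
    (μ := volume.restrict Ω.carrier) (f := f)
    ((integrableOn_of_memLp_two hf).integrable.locallyIntegrable.locallyIntegrableOn _)
    fun g hg hgs hgt => h g ⟨hg, hgs, hgt⟩
  filter_upwards [h1, ae_restrict_mem Ω.isOpen.measurableSet] with x hx hx'
  exact hx hx'

/-- The element of `H¹₀(Ω)` given by a test function. -/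
theorem exists_h10_of_isTestFunction {φ : EuclideanSpace ℝ (Fin d) → ℝ} (hφ : IsTestFunction Ω φ) :
    ∃ w : H10 Ω, w.fn =ᵐ[volume.restrict Ω.carrier] φ := by
  have h1 : MemLp φ 2 (volume.restrict Ω.carrier) :=
    memLp_two_of_hasCompactSupport hφ.smooth.continuous hφ.compact
  have h2 : MemLp (gradient φ) 2 (volume.restrict Ω.carrier) :=
    memLp_two_of_hasCompactSupport hφ.continuous_gradient hφ.hasCompactSupport_gradient
  exact ⟨⟨(h1.toLp φ, h2.toLp _), (testGraph Ω).le_topologicalClosure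
    ⟨φ, hφ, h1.coeFn_toLp, h2.coeFn_toLp⟩⟩, h1.coeFn_toLp⟩

/-- The second component of an element of `H¹₀(Ω)` is the weak gradient of the first. -/
theorem integral_mul_fderiv_eq_neg {p : L2 Ω × L2Vec Ω} (hp : p ∈ h10Graph Ω)
    {ψ : EuclideanSpace ℝ (Fin d) → ℝ} (hψ : IsTestFunction Ω ψ) (e : EuclideanSpace ℝ (Fin d)) :
    ∫ x in Ω.carrier, fderiv ℝ ψ x e * p.1 x = -∫ x in Ω.carrier, ⟪ψ x • e, p.2 x⟫_ℝ := by
  have hψd : Continuous fun x => fderiv ℝ ψ x e :=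
    (hψ.smooth.continuous_fderiv (by simp)).clm_apply continuous_const
  have hψds : HasCompactSupport fun x => fderiv ℝ ψ x e := hψ.compact.fderiv_apply (𝕜 := ℝ) e
  have h1 : MemLp (fun x => fderiv ℝ ψ x e) 2 (volume.restrict Ω.carrier) :=
    memLp_two_of_hasCompactSupport hψd hψds
  have h2 : MemLp (fun x => ψ x • e) 2 (volume.restrict Ω.carrier) :=
    memLp_two_of_hasCompactSupport (hψ.smooth.continuous.smul continuous_const)
      hψ.compact.smul_right
  have e1 : ∀ q : L2 Ω, ∫ x in Ω.carrier, fderiv ℝ ψ x e * q x = ⟪h1.toLp _, q⟫_ℝ := fun q => by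
    rw [L2.inner_def]
    refine integral_congr_ae ?_
    filter_upwards [h1.coeFn_toLp] with x hx
    rw [hx]; exact mul_comm _ _
  have e2 : ∀ q : L2Vec Ω, ∫ x in Ω.carrier, ⟪ψ x • e, q x⟫_ℝ = ⟪h2.toLp _, q⟫_ℝ := fun q => by
    rw [L2.inner_def]
    refine integral_congr_ae ?_
    filter_upwards [h2.coeFn_toLp] with x hx
    rw [hx]
  rw [e1, e2]
  have hcl : IsClosed {p : L2 Ω × L2Vec Ω | ⟪h1.toLp _, p.1⟫_ℝ = -⟪h2.toLp _, p.2⟫_ℝ} :=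
    isClosed_eq (by fun_prop) (by fun_prop)
  refine closure_minimal ?_ hcl hp
  rintro p ⟨φ, hφ, k1, k2⟩
  change ⟪h1.toLp _, p.1⟫_ℝ = -⟪h2.toLp _, p.2⟫_ℝ
  rw [← e1, ← e2]
  have hφd : Continuous fun x => fderiv ℝ φ x e :=
    (hφ.smooth.continuous_fderiv (by simp)).clm_apply continuous_const
  have a1 : ∫ x in Ω.carrier, fderiv ℝ ψ x e * p.1 x = ∫ x, φ x * fderiv ℝ ψ x e := by
    rw [← setIntegral_eq_integral_of_forall_compl_eq_zero (s := Ω.carrier)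
        (f := fun x => φ x * fderiv ℝ ψ x e) (fun x hx => by
          rw [image_eq_zero_of_notMem_tsupport fun h => hx (hφ.subset h), zero_mul])]
    refine integral_congr_ae ?_
    filter_upwards [k1] with x hx
    rw [hx, mul_comm]
  have a2 : ∫ x in Ω.carrier, ⟪ψ x • e, p.2 x⟫_ℝ = ∫ x, fderiv ℝ φ x e * ψ x := by
    rw [← setIntegral_eq_integral_of_forall_compl_eq_zero (s := Ω.carrier)
        (f := fun x => fderiv ℝ φ x e * ψ x) (fun x hx => by
          rw [image_eq_zero_of_notMem_tsupport fun h => hx (hψ.subset h), mul_zero])]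
    refine integral_congr_ae ?_
    filter_upwards [k2] with x hx
    rw [hx, real_inner_smul_left, real_inner_comm, mul_comm]
    simp [gradient]
  rw [a1, a2]
  exact integral_mul_fderiv_eq_neg_fderiv_mul_of_integrable
    ((hφd.mul hψ.smooth.continuous).integrable_of_hasCompactSupport hψ.compact.mul_left)
    ((hφ.smooth.continuous.mul hψd).integrable_of_hasCompactSupport hφ.compact.mul_right)
    ((hφ.smooth.continuous.mul hψ.smooth.continuous).integrable_of_hasCompactSupport
      hφ.compact.mul_right)
    (fun x _ => hφ.smooth.differentiable (by simp) x)
    (fun x _ => hψ.smooth.differentiable (by simp) x)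

variable [NeZero d]

/-- Elements are pairs of a function and a gradient, so the content is closability of the gradient:
the second component is a weak gradient of the first, and that of `0` is `0`. -/
theorem embL2_injective (Ω : BoundedDomain d) : Function.Injective (H10.embL2 Ω) := by
  refine (injective_iff_map_eq_zero _).2 fun u hu => ?_
  have hu' : u.1.1 = 0 := hu
  have h2 := Lp.memLp u.1.2
  have h : u.1.2 = 0 := by
    refine Lp.eq_zero_iff_ae_eq_zero.2 (ae_eq_zero_of_integral_testFunction h2 fun ψ hψ => ?_)
    have hi : IntegrableOn (fun x => ψ x • u.1.2 x) Ω.carrier :=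
      memLp_one_iff_integrable.1 (h2.smul (p := 2) (q := 2)
        (memLp_two_of_hasCompactSupport hψ.smooth.continuous hψ.compact))
    refine ext_inner_left ℝ fun e => ?_
    have h3 := integral_mul_fderiv_eq_neg u.2 hψ e
    rw [← integral_inner hi, inner_zero_right]
    have h4 : ∫ x in Ω.carrier, fderiv ℝ ψ x e * u.1.1 x = 0 := by
      refine integral_eq_zero_of_ae ?_
      filter_upwards [Lp.eq_zero_iff_ae_eq_zero.1 hu'] with x hx
      rw [hx]; simp
    rw [h4, eq_comm, neg_eq_zero] at h3
    rw [← h3]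
    refine integral_congr_ae (Eventually.of_forall fun x => ?_)
    simp only [real_inner_smul_left, real_inner_smul_right]
  rw [← norm_le_zero_iff, H10.norm_eq]
  exact norm_le_zero_iff.2 h

/-- Test functions lie in `H¹₀(Ω)`, so the fundamental lemma of the calculus of variations applies.
-/
theorem l2ToHm1_injective (Ω : BoundedDomain d) : Function.Injective (l2ToHm1 Ω) := by
  refine (injective_iff_map_eq_zero _).2 fun f hf => ?_
  refine Lp.eq_zero_iff_ae_eq_zero.2
    (ae_eq_zero_of_integral_testFunction (Lp.memLp f) fun φ hφ => ?_)
  obtain ⟨w, hw⟩ := exists_h10_of_isTestFunction hφ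
  have h := l2ToHm1_apply f w
  rw [hf, map_zero] at h
  refine Eq.trans (integral_congr_ae ?_) h.symm
  filter_upwards [hw] with x hx
  rw [hx, smul_eq_mul, mul_comm]

end Sobolev

/-! ### The heat semigroup on `H⁻¹(Ω)` and the isometry `∂ₜ + A`. -/

section Heat

variable {d : ℕ} [NeZero d]

/-- The solution operator `A⁻¹ : H⁻¹(Ω) → L²(Ω)`. -/
def solL2 (Ω : BoundedDomain d) : Hm1 Ω →L[ℝ] L2 Ω :=
  H10.embL2 Ω ∘L ((laplacian Ω).symm : Hm1 Ω →L[ℝ] H10 Ω)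

variable {Ω : BoundedDomain d}

theorem inner_laplacian_symm (f : Hm1 Ω) (w : H10 Ω) :
    ⟪(laplacian Ω).symm f, w⟫_ℝ = Hm1.toFunctional Ω f w :=
  InnerProductSpace.toDual_symm_apply

theorem inner_laplacian (u w : H10 Ω) : ⟪laplacian Ω u, laplacian Ω w⟫_ℝ = ⟪u, w⟫_ℝ := by
  have h : ∀ f g : Hm1 Ω, ⟪f, g⟫_ℝ = ⟪(laplacian Ω).symm f, (laplacian Ω).symm g⟫_ℝ :=
    fun _ _ => rfl
  rw [h, ContinuousLinearEquiv.symm_apply_apply, ContinuousLinearEquiv.symm_apply_apply]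

/-- In the `H⁻¹` inner product `A⁻¹` is the Riesz map, so pairing `l2ToHm1 y` with `x` means
evaluating the functional `l2ToHm1 y` at `A⁻¹x`. -/
theorem adjoint_solL2 (Ω : BoundedDomain d) : (solL2 Ω).adjoint = l2ToHm1 Ω := by
  refine ((ContinuousLinearMap.eq_adjoint_iff _ _).2 fun y x => ?_).symm
  exact inner_laplacian_symm (l2ToHm1 Ω y) ((laplacian Ω).symm x)

theorem adjoint_embL2_apply (v : L2 Ω) :
    (H10.embL2 Ω).adjoint v = (laplacian Ω).symm (l2ToHm1 Ω v) := by
  refine ext_inner_right ℝ fun w => ?_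
  rw [ContinuousLinearMap.adjoint_inner_left, inner_laplacian_symm]
  rfl

theorem denseRange_solL2 (Ω : BoundedDomain d) : DenseRange (solL2 Ω) :=
  denseRange_of_adjoint_injective (by rw [adjoint_solL2]; exact l2ToHm1_injective Ω)

theorem denseRange_adjoint_solL2 (Ω : BoundedDomain d) : DenseRange (solL2 Ω).adjoint :=
  denseRange_of_adjoint_injective (by
    rw [ContinuousLinearMap.adjoint_adjoint]
    exact (embL2_injective Ω).comp (laplacian Ω).symm.injective)

/-- The solution operator `A⁻¹` as an operator in `H⁻¹(Ω)`. -/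
def solHm1 (Ω : BoundedDomain d) : Hm1 Ω →L[ℝ] Hm1 Ω := (solL2 Ω).adjoint ∘L solL2 Ω

theorem solHm1_apply (x : Hm1 Ω) : solHm1 Ω x = h10ToHm1 Ω ((laplacian Ω).symm x) := by
  rw [solHm1, adjoint_solL2]; rfl

theorem solHm1_laplacian (w : H10 Ω) : solHm1 Ω (laplacian Ω w) = h10ToHm1 Ω w := by
  rw [solHm1_apply, ContinuousLinearEquiv.symm_apply_apply]

theorem isPositive_solHm1 (Ω : BoundedDomain d) : (solHm1 Ω).IsPositive :=
  ContinuousLinearMap.isPositive_adjoint_comp_self _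

theorem denseRange_solHm1 (Ω : BoundedDomain d) : DenseRange (solHm1 Ω) :=
  (denseRange_adjoint_solL2 Ω).comp (denseRange_solL2 Ω) (ContinuousLinearMap.continuous _)

/-- The semigroup `e^{-At}` on `H⁻¹(Ω)`. -/
def heatSemigroup (Ω : BoundedDomain d) : ℝ → Hm1 Ω →L[ℝ] Hm1 Ω := invSemigroup (solHm1 Ω)

theorem exists_generator_iff (x y : Hm1 Ω) :
    (∃ w : H10 Ω, h10ToHm1 Ω w = x ∧ y = -laplacian Ω w) ↔ x = -solHm1 Ω y := by
  constructor
  · rintro ⟨w, rfl, rfl⟩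
    rw [map_neg, solHm1_laplacian, neg_neg]
  · rintro rfl
    refine ⟨-(laplacian Ω).symm y, ?_, ?_⟩
    · rw [map_neg, solHm1_apply]
    · rw [map_neg, ContinuousLinearEquiv.apply_symm_apply, neg_neg]

theorem isHeatSemigroup_heatSemigroup (Ω : BoundedDomain d) :
    IsHeatSemigroup Ω (heatSemigroup Ω) where
  zero := ContinuousLinearMap.ext fun x =>
    invSemigroup_of_nonpos (isPositive_solHm1 Ω) (denseRange_solHm1 Ω) le_rfl x
  add s t hs ht := ContinuousLinearMap.ext fun x =>
    invSemigroup_add (isPositive_solHm1 Ω) (denseRange_solHm1 Ω) hs ht x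
  continuousOn x :=
    (continuous_invSemigroup (isPositive_solHm1 Ω) (denseRange_solHm1 Ω) x).continuousOn
  generator x y := by
    rw [exists_generator_iff]
    exact tendsto_invSemigroup_quotient_iff (isPositive_solHm1 Ω) (denseRange_solHm1 Ω) x y

theorem IsHeatSemigroup.eq_heatSemigroup {S : ℝ → Hm1 Ω →L[ℝ] Hm1 Ω} (hS : IsHeatSemigroup Ω S)
    {t : ℝ} (ht : 0 ≤ t) : S t = heatSemigroup Ω t :=
  eq_invSemigroup (isPositive_solHm1 Ω) (denseRange_solHm1 Ω) hS.zero hS.add hS.continuousOn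
    (fun x y => by rw [hS.generator, exists_generator_iff]) ht

variable {T : ℝ}

theorem memLp_laplacian (u : L2Time T (H10 Ω)) :
    MemLp (fun t => laplacian Ω (u t)) 2 (volume.restrict (Ioc 0 T)) :=
  (laplacian Ω : H10 Ω →L[ℝ] Hm1 Ω).comp_memLp u

theorem adjoint_solL2_laplacian_ae {u : L2Time T (H10 Ω)} {f : ℝ → Hm1 Ω}
    (h : ∀ᵐ t ∂volume.restrict (Ioc 0 T), h10ToHm1 Ω (u t) = ∫ s in Ioc 0 t, f s) :
    ∀ᵐ t ∂volume.restrict (Ioc 0 T),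
      (solL2 Ω).adjoint (solL2 Ω (laplacian Ω (u t))) = ∫ s in Ioc 0 t, f s := by
  filter_upwards [h] with t ht
  rw [← ht]
  exact solHm1_laplacian (u t)

/-- States in `L²(H¹₀) ∩ H¹(H⁻¹)` that vanish at time `0` have a final value in `L²(Ω)`. -/
theorem existsUnique_u0 (u : L2Time T (H10 Ω)) (f : L2Time T (Hm1 Ω))
    (h : ∀ᵐ t ∂volume.restrict (Ioc 0 T), h10ToHm1 Ω (u t) = ∫ s in Ioc 0 t, f s) :
    ∃! w : U0 T Ω, U0.state T Ω w = u ∧ U0.timeDeriv T Ω w = f := by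
  obtain ⟨y, hy⟩ := exists_adjoint_eq_primitive (denseRange_solL2 Ω) (denseRange_adjoint_solL2 Ω)
    (memLp_laplacian u) (Lp.memLp f) (adjoint_solL2_laplacian_ae h)
  rw [adjoint_solL2] at hy
  refine ⟨⟨WithLp.toLp 2 (u, WithLp.toLp 2 (f, y)), h, hy⟩, ⟨rfl, rfl⟩, ?_⟩
  rintro ⟨⟨u', ⟨f', y'⟩⟩, h1, h2⟩ ⟨rfl, rfl⟩
  have e : y' = y := l2ToHm1_injective Ω (h2.trans hy.symm)
  subst e
  rfl

theorem heatOp_ae_eq (w : U0 T Ω) : heatOp T Ω w =ᵐ[volume.restrict (Ioc 0 T)]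
    fun t => U0.timeDeriv T Ω w t + laplacian Ω (U0.state T Ω w t) := by
  filter_upwards [Lp.coeFn_add (U0.timeDeriv T Ω w)
    ((laplacian Ω : H10 Ω →L[ℝ] Hm1 Ω).compLp (U0.state T Ω w)),
    (laplacian Ω : H10 Ω →L[ℝ] Hm1 Ω).coeFn_compLp (U0.state T Ω w)] with t h1 h2
  refine h1.trans ?_
  rw [Pi.add_apply, h2]
  rfl

/-- The energy identity with `z = A u`: since `⟪A u, uₜ⟫` in `H⁻¹` is the duality pairing of `uₜ`
with `u`, this integrates `d/dt ‖u‖² = 2⟨uₜ, u⟩`. -/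
theorem norm_sq_final (w : U0 T Ω) : ‖U0.final T Ω w‖ ^ 2 =
    2 * ∫ t in Ioc 0 T, ⟪laplacian Ω (U0.state T Ω w t), U0.timeDeriv T Ω w t⟫_ℝ :=
  norm_sq_eq_of_adjoint_eq_primitive (denseRange_solL2 Ω) (denseRange_adjoint_solL2 Ω)
    (memLp_laplacian _) (Lp.memLp _) (adjoint_solL2_laplacian_ae w.state_ae_eq)
    (by rw [adjoint_solL2]; exact w.final_eq)

/-- The heat operator is an isometry. -/
theorem norm_heatOp (w : U0 T Ω) : ‖heatOp T Ω w‖ = ‖w‖ := by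
  set Z : L2Time T (Hm1 Ω) := (laplacian Ω : H10 Ω →L[ℝ] Hm1 Ω).compLp (U0.state T Ω w) with hZ
  have hZae := (laplacian Ω : H10 Ω →L[ℝ] Hm1 Ω).coeFn_compLp (U0.state T Ω w)
  have h1 : heatOp T Ω w = U0.timeDeriv T Ω w + Z := rfl
  have h2 : ⟪w, w⟫_ℝ = ⟪U0.state T Ω w, U0.state T Ω w⟫_ℝ +
      (⟪U0.timeDeriv T Ω w, U0.timeDeriv T Ω w⟫_ℝ + ⟪U0.final T Ω w, U0.final T Ω w⟫_ℝ) := rfl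
  have h3 : ⟪Z, Z⟫_ℝ = ⟪U0.state T Ω w, U0.state T Ω w⟫_ℝ := by
    rw [L2.inner_def, L2.inner_def]
    refine integral_congr_ae ?_
    filter_upwards [hZae] with t ht
    rw [ht]
    exact inner_laplacian _ _
  have h4 : ⟪Z, U0.timeDeriv T Ω w⟫_ℝ =
      ∫ t in Ioc 0 T, ⟪laplacian Ω (U0.state T Ω w t), U0.timeDeriv T Ω w t⟫_ℝ := by
    rw [L2.inner_def]
    refine integral_congr_ae ?_
    filter_upwards [hZae] with t ht
    rw [ht]; rfl
  -- The cross term of the expanded square is exactly the final-value term of the `U0` norm.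
  have h5 := norm_sq_final w
  rw [← h4, ← real_inner_self_eq_norm_sq] at h5
  have h6 : ‖heatOp T Ω w‖ ^ 2 = ‖w‖ ^ 2 := by
    rw [← real_inner_self_eq_norm_sq, ← real_inner_self_eq_norm_sq, h2, h1, h5, ← h3,
      real_inner_add_add_self]
    linarith [real_inner_comm Z (U0.timeDeriv T Ω w)]
  exact (sq_eq_sq₀ (norm_nonneg _) (norm_nonneg _)).1 h6

theorem adjoint_heatOp_heatOp (w : U0 T Ω) : (heatOp T Ω).adjoint (heatOp T Ω w) = w :=
  congrArg (fun P : U0 T Ω →L[ℝ] U0 T Ω => P w)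
    ((heatOp T Ω).norm_map_iff_adjoint_comp_self.1 norm_heatOp)

theorem inner_heatOp (u w : U0 T Ω) : ⟪heatOp T Ω u, heatOp T Ω w⟫_ℝ = ⟪u, w⟫_ℝ := by
  rw [← ContinuousLinearMap.adjoint_inner_left, adjoint_heatOp_heatOp]

/-- Turns an explicit solution, given through `z = A w` and `f = wₜ`, into an element of `U0`; the
final value in `L²(Ω)` comes for free. -/
theorem exists_u0 {z f : ℝ → Hm1 Ω} (hz : MemLp z 2 (volume.restrict (Ioc 0 T)))
    (hf : MemLp f 2 (volume.restrict (Ioc 0 T)))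
    (h : ∀ t ∈ Icc 0 T, ∫ s in Ioc 0 t, f s = solHm1 Ω (z t)) :
    ∃ w : U0 T Ω, (∀ t ∈ Icc 0 T, w.atTime t = solHm1 Ω (z t)) ∧
      heatOp T Ω w =ᵐ[volume.restrict (Ioc 0 T)] fun t => f t + z t := by
  have hu : MemLp (fun t => (laplacian Ω).symm (z t)) 2 (volume.restrict (Ioc 0 T)) :=
    ((laplacian Ω).symm : Hm1 Ω →L[ℝ] H10 Ω).comp_memLp' hz
  have hfp : ∀ t ≤ T, ∫ s in Ioc 0 t, hf.toLp f s = ∫ s in Ioc 0 t, f s := fun t ht =>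
    integral_congr_ae (ae_restrict_of_ae_restrict_of_subset (Ioc_subset_Ioc_right ht)
      hf.coeFn_toLp)
  obtain ⟨w, ⟨hw1, hw2⟩, -⟩ := existsUnique_u0 (hu.toLp _) (hf.toLp f) (by
    filter_upwards [hu.coeFn_toLp, ae_restrict_mem measurableSet_Ioc] with t ht htT
    rw [ht, hfp t htT.2, h t ⟨htT.1.le, htT.2⟩, solHm1_apply])
  refine ⟨w, fun t ht => ?_, ?_⟩
  · rw [U0.atTime, hw2, hfp t ht.2, h t ht]
  · filter_upwards [heatOp_ae_eq w, hu.coeFn_toLp, hf.coeFn_toLp] with t h1 h2 h3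
    rw [h1, hw1, hw2, h2, h3, ContinuousLinearEquiv.apply_symm_apply]

end Heat

/-! ### The adjoints of the four blocks and of `𝒢`. -/

section Adjoints

variable {d : ℕ} [NeZero d] {Ω : BoundedDomain d} {T : ℝ}

theorem atTime_add (u w : U0 T Ω) {t : ℝ} (ht : t ≤ T) :
    (u + w).atTime t = u.atTime t + w.atTime t :=
  ext_inner_left ℝ fun c => by
    simp only [U0.atTime, inner_add_right, inner_primitive ht, map_add]

theorem continuous_inner_atTime {t : ℝ} (ht : t ≤ T) (c : Hm1 Ω) :
    Continuous fun w : U0 T Ω => ⟪c, w.atTime t⟫_ℝ := by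
  simp only [U0.atTime, inner_primitive ht]
  exact continuous_const.inner (U0.timeDeriv T Ω).continuous

theorem integrableOn_heatSemigroup {t : ℝ} (ht : t ≤ T) (v : L2Time T (Hm1 Ω)) :
    IntegrableOn (fun s => heatSemigroup Ω (t - s) (v s)) (Ioc 0 t) :=
  integrableOn_invSemigroup (isPositive_solHm1 Ω) (denseRange_solHm1 Ω) ht v

/-- The function on the right solves the heat equation with source `1_{(a,T]} x`, and the adjoint of
the isometry `∂ₜ + A` inverts it on its range. -/
theorem adjoint_heatOp_stepFn {a : ℝ} (ha : 0 ≤ a) (x : Hm1 Ω) {t : ℝ} (ht : t ∈ Icc 0 T) :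
    ((heatOp T Ω).adjoint (stepFn T a x)).atTime t = solHm1 Ω (x - heatSemigroup Ω (t - a) x) := by
  have hB := isPositive_solHm1 Ω
  have hd := denseRange_solHm1 Ω
  have hc : Continuous fun t => heatSemigroup Ω (t - a) x :=
    (continuous_invSemigroup hB hd x).comp (continuous_id.sub continuous_const)
  have hb : ∀ t, ‖heatSemigroup Ω (t - a) x‖ ≤ ‖x‖ := fun t => norm_invSemigroup_le hB hd _ _
  have hS : MemLp (fun t => heatSemigroup Ω (t - a) x) 2 (volume.restrict (Ioc 0 T)) :=
    MemLp.of_bound hc.aestronglyMeasurable ‖x‖ (Eventually.of_forall hb)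
  obtain ⟨w, hw1, hw2⟩ := exists_u0 ((memLp_const x).sub hS)
    (hS.indicator (measurableSet_Ioi (a := a)))
    (fun t _ => setIntegral_indicator_invSemigroup hB hd ha x)
  have hw : heatOp T Ω w = stepFn T a x := by
    refine Lp.ext ?_
    filter_upwards [hw2, stepFn_ae_eq T a x] with t h1 h2
    rw [h1, h2]
    by_cases h : t ∈ Ioi a
    · rw [indicator_of_mem h, indicator_of_mem h]
      simp
    · rw [indicator_of_notMem h, indicator_of_notMem h]
      have : heatSemigroup Ω (t - a) x = x :=
        invSemigroup_of_nonpos hB hd (sub_nonpos.2 (not_lt.1 h)) x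
      simp [this]
  rw [← hw, adjoint_heatOp_heatOp]
  exact hw1 t ht

/-- Duhamel's formula for `(∂ₜ + A)*`. -/
theorem adjoint_heatOp_atTime (v : L2Time T (Hm1 Ω)) {t : ℝ} (ht : t ∈ Icc 0 T) :
    ((heatOp T Ω).adjoint v).atTime t = ∫ s in Ioc 0 t, heatSemigroup Ω (t - s) (v s) := by
  have hB := isPositive_solHm1 Ω
  have hd := denseRange_solHm1 Ω
  refine ext_inner_left ℝ fun c => ?_
  obtain ⟨g, hg⟩ := exists_inner_duhamel hB hd ht.2 c
  let q : L2Time T (Hm1 Ω) := indicatorConstLp 2 (measurableSet_Ioc (a := 0) (b := t))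
    (measure_ne_top (volume.restrict (Ioc 0 T)) _) c
  -- The Riesz representative of `v ↦ ⟪c, ((∂ₜ + A)* v)(t)⟫`; `g` represents the Duhamel side, and
  -- the two are compared on step functions.
  let p : L2Time T (Hm1 Ω) := heatOp T Ω ((U0.timeDeriv T Ω).adjoint q)
  have hp : ∀ v, ⟪c, ((heatOp T Ω).adjoint v).atTime t⟫_ℝ = ⟪p, v⟫_ℝ := fun v => by
    rw [U0.atTime, inner_primitive ht.2, ← ContinuousLinearMap.adjoint_inner_left,
      ContinuousLinearMap.adjoint_inner_right]
  have hpg : p - g = 0 := eq_zero_of_inner_stepFn fun a ha x => by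
    rw [real_inner_comm, inner_sub_left, ← hp, ← hg, adjoint_heatOp_stepFn ha.1 x ht,
      duhamel_stepFn hB hd ha.1 ht.2]
    exact sub_self _
  rw [hp, sub_eq_zero.1 hpg, ← hg]
  rfl

theorem atTime_eq_duhamel (u : U0 T Ω) {t : ℝ} (ht : t ∈ Icc 0 T) :
    u.atTime t = ∫ s in Ioc 0 t, heatSemigroup Ω (t - s) (heatOp T Ω u s) := by
  rw [← adjoint_heatOp_atTime _ ht, adjoint_heatOp_heatOp]

theorem solHm1_heatSemigroup_sub {s t : ℝ} (hs : 0 ≤ s) (hst : s ≤ t) (x : Hm1 Ω) :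
    solHm1 Ω (heatSemigroup Ω s x - heatSemigroup Ω t x) = ∫ r in s..t, heatSemigroup Ω r x :=
  apply_invSemigroup_sub (isPositive_solHm1 Ω) (denseRange_solHm1 Ω) hs hst x

theorem solHm1_heatSemigroup (t : ℝ) (x : Hm1 Ω) :
    solHm1 Ω (heatSemigroup Ω t x) = heatSemigroup Ω t (solHm1 Ω x) :=
  apply_invSemigroup (isPositive_solHm1 Ω) (denseRange_solHm1 Ω) t x

theorem heatSemigroup_zero_apply (x : Hm1 Ω) : heatSemigroup Ω 0 x = x :=
  invSemigroup_of_nonpos (isPositive_solHm1 Ω) (denseRange_solHm1 Ω) le_rfl x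

theorem continuous_heatSemigroup (x : Hm1 Ω) : Continuous fun t => heatSemigroup Ω t x :=
  continuous_invSemigroup (isPositive_solHm1 Ω) (denseRange_solHm1 Ω) x

/-- Substitution in the symmetrized Duhamel integral. -/
theorem setIntegral_heatSemigroup_symm {t : ℝ} (ht : t ∈ Icc 0 T) (x : Hm1 Ω) :
    ∫ s in Ioc 0 t, heatSemigroup Ω (T + t - 2 * s) x =
      solHm1 Ω ((1 / 2 : ℝ) • (heatSemigroup Ω (T - t) x - heatSemigroup Ω (T + t) x)) := by
  rw [map_smul, solHm1_heatSemigroup_sub (sub_nonneg.2 ht.2) (by linarith [ht.1]),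
    ← intervalIntegral.integral_of_le ht.1,
    intervalIntegral.integral_comp_sub_mul (fun r => heatSemigroup Ω r x) two_ne_zero]
  rw [mul_zero, sub_zero, one_div, show T + t - 2 * t = T - t by ring]

theorem setIntegral_heatSemigroup_add {t : ℝ} (ht : t ∈ Icc 0 T) (x : Hm1 Ω) :
    ∫ s in Ioc 0 t, (1 / 2 : ℝ) • (heatSemigroup Ω (T - s) x + heatSemigroup Ω (T + s) x) =
      solHm1 Ω ((1 / 2 : ℝ) • (heatSemigroup Ω (T - t) x - heatSemigroup Ω (T + t) x)) := by
  have h1 : Continuous fun s => heatSemigroup Ω (T - s) x :=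
    (continuous_heatSemigroup x).comp (continuous_const.sub continuous_id)
  have h2 : Continuous fun s => heatSemigroup Ω (T + s) x :=
    (continuous_heatSemigroup x).comp (continuous_const.add continuous_id)
  rw [map_smul, solHm1_heatSemigroup_sub (sub_nonneg.2 ht.2) (by linarith [ht.1]),
    integral_smul, ← intervalIntegral.integral_of_le ht.1,
    intervalIntegral.integral_add (h1.intervalIntegrable _ _) (h2.intervalIntegrable _ _),
    intervalIntegral.integral_comp_sub_left (fun r => heatSemigroup Ω r x),
    intervalIntegral.integral_comp_add_left (fun r => heatSemigroup Ω r x), sub_zero, add_zero,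
    intervalIntegral.integral_add_adjacent_intervals
      ((continuous_heatSemigroup x).intervalIntegrable _ _)
      ((continuous_heatSemigroup x).intervalIntegrable _ _)]

/-- Move `A⁻¹` across as the embedding into `H⁻¹`, write `u(T)` by Duhamel's formula, and use
symmetry of the semigroup. -/
theorem inner_final_solL2 (hT : 0 ≤ T) (u : U0 T Ω) (x : Hm1 Ω) {p : L2Time T (Hm1 Ω)}
    (hp : p =ᵐ[volume.restrict (Ioc 0 T)] fun s => heatSemigroup Ω (T - s) x) :
    ⟪U0.final T Ω u, solL2 Ω x⟫_ℝ = ⟪heatOp T Ω u, p⟫_ℝ := by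
  rw [← ContinuousLinearMap.adjoint_inner_left, adjoint_solL2, u.final_eq,
    atTime_eq_duhamel u ⟨hT, le_rfl⟩, real_inner_comm,
    ← integral_inner (integrableOn_heatSemigroup le_rfl _), L2.inner_def]
  refine integral_congr_ae ?_
  filter_upwards [hp] with s hs
  rw [hs, real_inner_comm]
  exact invSemigroup_inner (isPositive_solHm1 Ω) (denseRange_solHm1 Ω) _ _ _

/-- The source `e^{-A(T-t)}x` is the sum of `wₜ = ½[e^{-A(T-t)} + e^{-A(T+t)}]x` and `A w =
½[e^{-A(T-t)} - e^{-A(T+t)}]x`. The reflected term `e^{-A(T+t)}` enforces `w(0) = 0`. -/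
theorem adjoint_final_solL2 (hT : 0 ≤ T) (x : Hm1 Ω) {t : ℝ} (ht : t ∈ Icc 0 T) :
    ((U0.final T Ω).adjoint (solL2 Ω x)).atTime t =
      solHm1 Ω ((1 / 2 : ℝ) • (heatSemigroup Ω (T - t) x - heatSemigroup Ω (T + t) x)) := by
  have hb : ∀ t, ‖heatSemigroup Ω t x‖ ≤ ‖x‖ := fun t =>
    norm_invSemigroup_le (isPositive_solHm1 Ω) (denseRange_solHm1 Ω) _ _
  have h1 : MemLp (fun s => heatSemigroup Ω (T - s) x) 2 (volume.restrict (Ioc 0 T)) :=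
    MemLp.of_bound ((continuous_heatSemigroup x).comp
      (continuous_const.sub continuous_id)).aestronglyMeasurable ‖x‖
      (Eventually.of_forall fun s => hb _)
  have h2 : MemLp (fun s => heatSemigroup Ω (T + s) x) 2 (volume.restrict (Ioc 0 T)) :=
    MemLp.of_bound ((continuous_heatSemigroup x).comp
      (continuous_const.add continuous_id)).aestronglyMeasurable ‖x‖
      (Eventually.of_forall fun s => hb _)
  obtain ⟨w, hw1, hw2⟩ := exists_u0 ((h1.sub h2).const_smul (1 / 2 : ℝ))
    ((h1.add h2).const_smul (1 / 2 : ℝ)) (fun t ht => setIntegral_heatSemigroup_add ht x)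
  have hw : (U0.final T Ω).adjoint (solL2 Ω x) = w := by
    refine ext_inner_left ℝ fun u => ?_
    rw [ContinuousLinearMap.adjoint_inner_right, ← inner_heatOp]
    refine inner_final_solL2 hT u x ?_
    filter_upwards [hw2] with s hs
    rw [hs]
    simp only [Pi.smul_apply, Pi.add_apply, Pi.sub_apply]
    module
  rw [hw]
  exact hw1 t ht

/-- Tested against `c`, both sides are continuous in `v`, and the range of `solL2` is dense. -/
theorem adjoint_final_atTime (hT : 0 ≤ T) (v : L2 Ω) {t : ℝ} (ht : t ∈ Icc 0 T) :
    ((U0.final T Ω).adjoint v).atTime t =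
      (1 / 2 : ℝ) • (heatSemigroup Ω (T - t) (l2ToHm1 Ω v) -
        heatSemigroup Ω (T + t) (l2ToHm1 Ω v)) := by
  refine ext_inner_left ℝ fun c => ?_
  have h1 : Continuous fun v : L2 Ω => ⟪c, ((U0.final T Ω).adjoint v).atTime t⟫_ℝ :=
    (continuous_inner_atTime ht.2 c).comp (ContinuousLinearMap.continuous _)
  have h2 : Continuous fun v : L2 Ω => ⟪c, (1 / 2 : ℝ) •
      (heatSemigroup Ω (T - t) (l2ToHm1 Ω v) - heatSemigroup Ω (T + t) (l2ToHm1 Ω v))⟫_ℝ := by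
    fun_prop
  refine congrFun ((denseRange_solL2 Ω).equalizer h1 h2 (funext fun x => ?_)) v
  simp only [Function.comp_apply]
  rw [adjoint_final_solL2 hT x ht, map_smul, map_sub, solHm1_heatSemigroup, solHm1_heatSemigroup,
    solHm1, adjoint_solL2]
  rfl

theorem adjoint_constLaplacian (v : L2Time T (Hm1 Ω)) :
    (constLaplacian T Ω).adjoint v = (laplacian Ω).symm (∫ s in Ioc 0 T, v s) := by
  refine ext_inner_left ℝ fun w => ?_
  rw [ContinuousLinearMap.adjoint_inner_right, ← inner_laplacian,
    ContinuousLinearEquiv.apply_symm_apply, inner_primitive le_rfl]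
  congr 1
  refine Lp.ext ?_
  filter_upwards [Lp.coeFn_const (p := 2) (μ := volume.restrict (Ioc 0 T)) (laplacian Ω w),
    indicatorConstLp_coeFn (p := 2) (hs := measurableSet_Ioc (a := 0) (b := T))
      (hμs := measure_ne_top (volume.restrict (Ioc 0 T)) _) (c := laplacian Ω w),
    ae_restrict_mem measurableSet_Ioc] with t h1 h2 ht
  rw [h2, indicator_of_mem ht]
  exact h1

theorem adjoint_allAtOnce (v : L2Time T (Hm1 Ω)) (y : L2 Ω) :
    (allAtOnce T Ω).adjoint (WithLp.toLp 2 (v, y)) =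
      WithLp.toLp 2 ((heatOp T Ω).adjoint v + (U0.final T Ω).adjoint y,
        (constLaplacian T Ω).adjoint v + (H10.embL2 Ω).adjoint y) := by
  refine ext_inner_left ℝ fun p => ?_
  rw [ContinuousLinearMap.adjoint_inner_right]
  have h1 : ⟪allAtOnce T Ω p, WithLp.toLp 2 (v, y)⟫_ℝ =
      ⟪heatOp T Ω p.fst + constLaplacian T Ω p.snd, v⟫_ℝ +
        ⟪U0.final T Ω p.fst + H10.embL2 Ω p.snd, y⟫_ℝ := rfl
  have h2 : ∀ a b, ⟪p, WithLp.toLp 2 (a, b)⟫_ℝ = ⟪p.fst, a⟫_ℝ + ⟪p.snd, b⟫_ℝ := fun _ _ => rfl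
  rw [h1, h2]
  simp only [inner_add_left, inner_add_right, ContinuousLinearMap.adjoint_inner_right]
  ring

theorem allAtOnce_toLp (u : U0 T Ω) (θ : H10 Ω) : allAtOnce T Ω (WithLp.toLp 2 (u, θ)) =
    WithLp.toLp 2 (heatOp T Ω u + constLaplacian T Ω θ, U0.final T Ω u + H10.embL2 Ω θ) := rfl

end Adjoints

/-! ### The entries of `𝒢*𝒢`. -/

section Normal

variable {d : ℕ} [NeZero d] {Ω : BoundedDomain d} {T : ℝ}

theorem constLaplacian_ae_eq (θ : H10 Ω) :
    constLaplacian T Ω θ =ᵐ[volume.restrict (Ioc 0 T)] fun _ => laplacian Ω θ :=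
  Lp.coeFn_const (p := 2) (μ := volume.restrict (Ioc 0 T)) (laplacian Ω θ)

theorem setIntegral_constLaplacian (hT : 0 ≤ T) (θ : H10 Ω) :
    ∫ s in Ioc 0 T, constLaplacian T Ω θ s = T • laplacian Ω θ := by
  rw [integral_congr_ae (constLaplacian_ae_eq θ)]
  simp [hT]

theorem adjoint_heatOp_constLaplacian (θ : H10 Ω) {t : ℝ} (ht : t ∈ Icc 0 T) :
    ((heatOp T Ω).adjoint (constLaplacian T Ω θ)).atTime t =
      h10ToHm1 Ω θ - heatSemigroup Ω t (h10ToHm1 Ω θ) := by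
  have e : ∀ᵐ s ∂volume.restrict (Ioc 0 t),
      heatSemigroup Ω (t - s) (constLaplacian T Ω θ s) =
        heatSemigroup Ω (t - s) (laplacian Ω θ) := by
    filter_upwards [ae_restrict_of_ae_restrict_of_subset (Ioc_subset_Ioc_right ht.2)
      (constLaplacian_ae_eq θ)] with s hs
    rw [hs]
  rw [adjoint_heatOp_atTime _ ht, integral_congr_ae e, ← intervalIntegral.integral_of_le ht.1,
    intervalIntegral.integral_comp_sub_left (fun r => heatSemigroup Ω r (laplacian Ω θ)), sub_self,
    sub_zero, ← solHm1_heatSemigroup_sub le_rfl ht.1, map_sub, heatSemigroup_zero_apply,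
    solHm1_heatSemigroup, solHm1_laplacian]

/-- The time derivative integrates to `u(T)`, so after `A⁻¹` this contributes one of the two copies
of `A⁻¹δ_T` in `𝒢*𝒢`. -/
theorem setIntegral_heatOp (u : U0 T Ω) :
    ∫ s in Ioc 0 T, heatOp T Ω u s =
      l2ToHm1 Ω (U0.final T Ω u) + laplacian Ω (∫ s in Ioc 0 T, U0.state T Ω u s) := by
  have h1 : IntegrableOn (U0.state T Ω u) (Ioc 0 T) := (Lp.memLp _).integrable (by norm_num)
  have h2 : IntegrableOn (U0.timeDeriv T Ω u) (Ioc 0 T) := (Lp.memLp _).integrable (by norm_num)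
  have h3 : IntegrableOn (fun t => laplacian Ω (U0.state T Ω u t)) (Ioc 0 T) :=
    (memLp_laplacian _).integrable (by norm_num)
  rw [integral_congr_ae (heatOp_ae_eq u), integral_add h2 h3, u.final_eq]
  congr 1
  exact (laplacian Ω : H10 Ω →L[ℝ] Hm1 Ω).integral_comp_comm h1

end Normal
end BackwardsHeat
end

/-! ### Assembly of the statements. -/

theorem mainTheorem4 {d : ℕ} [NeZero d] (Ω : BoundedDomain d) (T : ℝ) (hT : 0 < T) :
    -- states in `L²(H¹₀) ∩ H¹(H⁻¹)` vanishing at time `0` have a final value in `L²(Ω)`, so `U₀`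
    -- consists of exactly these states
    (∀ (u : L2Time T (H10 Ω)) (f : L2Time T (Hm1 Ω)),
      (∀ᵐ t ∂volume.restrict (Ioc 0 T), h10ToHm1 Ω (u t) = ∫ s in Ioc 0 t, f s) →
      ∃! w : U0 T Ω, U0.state T Ω w = u ∧ U0.timeDeriv T Ω w = f) ∧
    -- the heat semigroup exists and is unique
    ∃ S : ℝ → Hm1 Ω →L[ℝ] Hm1 Ω, IsHeatSemigroup Ω S ∧
      (∀ S', IsHeatSemigroup Ω S' → ∀ t, 0 ≤ t → S' t = S t) ∧
      -- `(∂ₜ + A)* v = ∫₀ᵗ e^{-A(t-s)} v(s) ds`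
      (∀ v : L2Time T (Hm1 Ω), ∀ t ∈ Icc 0 T,
        IntegrableOn (fun s => S (t - s) (v s)) (Ioc 0 t) ∧
        ((heatOp T Ω).adjoint v).atTime t = ∫ s in Ioc 0 t, S (t - s) (v s)) ∧
      -- `δ_T* v = A ∫₀ᵗ e^{-A(T+t-2s)} v ds = ½ [e^{-A(T-t)} - e^{-A(T+t)}] v`
      (∀ v : L2 Ω, ∀ t ∈ Icc 0 T,
        ((U0.final T Ω).adjoint v).atTime t =
          (1 / 2 : ℝ) • (S (T - t) (l2ToHm1 Ω v) - S (T + t) (l2ToHm1 Ω v)) ∧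
        ∃ q : H10 Ω, h10ToHm1 Ω q = ∫ s in Ioc 0 t, S (T + t - 2 * s) (l2ToHm1 Ω v) ∧
          ((U0.final T Ω).adjoint v).atTime t = laplacian Ω q) ∧
      -- `(I̲A)* v = A⁻¹ ∫₀ᵀ v(s) ds`
      (∀ v : L2Time T (Hm1 Ω),
        (constLaplacian T Ω).adjoint v = (laplacian Ω).symm (∫ s in Ioc 0 T, v s)) ∧
      -- `I* v = A⁻¹ v`
      (∀ v : L2 Ω, (H10.embL2 Ω).adjoint v = (laplacian Ω).symm (l2ToHm1 Ω v)) ∧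
      -- `𝒢*`
      (∀ (v : L2Time T (Hm1 Ω)) (y : L2 Ω),
        (∀ t ∈ Icc 0 T,
          ((allAtOnce T Ω).adjoint (WithLp.toLp 2 (v, y))).fst.atTime t =
            (∫ s in Ioc 0 t, S (t - s) (v s)) +
            (1 / 2 : ℝ) • (S (T - t) (l2ToHm1 Ω y) - S (T + t) (l2ToHm1 Ω y))) ∧
        ((allAtOnce T Ω).adjoint (WithLp.toLp 2 (v, y))).snd =
          (laplacian Ω).symm (∫ s in Ioc 0 T, v s) + (laplacian Ω).symm (l2ToHm1 Ω y)) ∧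
      -- `𝒢*𝒢`
      (∀ (u : U0 T Ω) (θ : H10 Ω),
        (∀ t ∈ Icc 0 T,
          ((allAtOnce T Ω).adjoint (allAtOnce T Ω (WithLp.toLp 2 (u, θ)))).fst.atTime t =
            (u.atTime t + (1 / 2 : ℝ) • (S (T - t) (l2ToHm1 Ω (U0.final T Ω u)) -
              S (T + t) (l2ToHm1 Ω (U0.final T Ω u)))) +
            (h10ToHm1 Ω θ - S t (h10ToHm1 Ω θ) +
              (1 / 2 : ℝ) • (S (T - t) (h10ToHm1 Ω θ) - S (T + t) (h10ToHm1 Ω θ)))) ∧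
        ((allAtOnce T Ω).adjoint (allAtOnce T Ω (WithLp.toLp 2 (u, θ)))).snd =
          ((∫ s in Ioc 0 T, U0.state T Ω u s) +
            (2 : ℝ) • (laplacian Ω).symm (l2ToHm1 Ω (U0.final T Ω u))) +
          (T • θ + (laplacian Ω).symm (h10ToHm1 Ω θ))) := by
  have hfst : ∀ (v : L2Time T (Hm1 Ω)) (y : L2 Ω),
      ((allAtOnce T Ω).adjoint (WithLp.toLp 2 (v, y))).fst =
        (heatOp T Ω).adjoint v + (U0.final T Ω).adjoint y := fun v y => by
    rw [adjoint_allAtOnce]; rfl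
  have hsnd : ∀ (v : L2Time T (Hm1 Ω)) (y : L2 Ω),
      ((allAtOnce T Ω).adjoint (WithLp.toLp 2 (v, y))).snd =
        (constLaplacian T Ω).adjoint v + (H10.embL2 Ω).adjoint y := fun v y => by
    rw [adjoint_allAtOnce]; rfl
  have hθ : ∀ θ : H10 Ω, l2ToHm1 Ω (H10.embL2 Ω θ) = h10ToHm1 Ω θ := fun _ => rfl
  refine ⟨existsUnique_u0, heatSemigroup Ω, isHeatSemigroup_heatSemigroup Ω,
    fun S' hS' t ht => hS'.eq_heatSemigroup ht,
    fun v t ht => ⟨integrableOn_heatSemigroup ht.2 v, adjoint_heatOp_atTime v ht⟩,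
    fun v t ht => ⟨adjoint_final_atTime hT.le v ht, ?_⟩, adjoint_constLaplacian,
    adjoint_embL2_apply, fun v y => ⟨fun t ht => ?_, ?_⟩, fun u θ => ⟨fun t ht => ?_, ?_⟩⟩
  · refine ⟨(laplacian Ω).symm (((U0.final T Ω).adjoint v).atTime t), ?_, ?_⟩
    · rw [← solHm1_apply, adjoint_final_atTime hT.le v ht, setIntegral_heatSemigroup_symm ht]
    · rw [ContinuousLinearEquiv.apply_symm_apply]
  · rw [hfst, atTime_add _ _ ht.2, adjoint_heatOp_atTime v ht, adjoint_final_atTime hT.le y ht]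
  · rw [hsnd, adjoint_constLaplacian, adjoint_embL2_apply]
  · rw [allAtOnce_toLp, hfst, map_add, map_add, atTime_add _ _ ht.2, atTime_add _ _ ht.2,
      atTime_add _ _ ht.2, adjoint_heatOp_heatOp, adjoint_heatOp_constLaplacian θ ht,
      adjoint_final_atTime hT.le _ ht, adjoint_final_atTime hT.le _ ht, hθ]
    abel
  -- One copy of `A⁻¹u(T)` comes from `∫ uₜ`, the other from `I*δ_T`.
  · rw [allAtOnce_toLp, hsnd, map_add, map_add, adjoint_constLaplacian, adjoint_constLaplacian,
      adjoint_embL2_apply, adjoint_embL2_apply, hθ, setIntegral_heatOp,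
      setIntegral_constLaplacian hT.le, map_add, map_smul,
      ContinuousLinearEquiv.symm_apply_apply, ContinuousLinearEquiv.symm_apply_apply]
    module
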